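/- All graphs are finite, simple and undirected; the graph $G$ below may have twins (distinct vertices with the same closed neighbourhood). For a family $\mathcal N$ of sets, $G$ is an $\mathcal N$-graph if there is a map $f:V(G)\to\mathcal N$ such that distinct vertices $u,v$ are adjacent if and only if $f(u)\cap f(v)\neq\emptyset$. $G$ is an interval graph if it is an $\mathcal I$-graph, where $\mathcal I$ is the set of all closed, open, open-closed and closed-open intervals $[x,y],(x,y),(x,y],[x,y)$ with $x,y\in\mathbb R$. $G$ is a mixed unit interval graph if it is a $\mathcal U$-graph, where $\mathcal U$ is the set of all intervals $[x,x+1],(x,x+1),(x,x+1],[x,x+1)$ with $x\in\mathbb R$. For a set $\mathcal M$ of graphs, $G$ is $\mathcal M$-free if no member of $\mathcal M$ is isomorphic to an induced subgraph of $G$. Define the following graphs (all listed vertices are distinct, and there are no edges other than those listed). - $R_i$ ($i\ge 0$): vertices $p_0,\dots,p_{i+2}$, $q_0,\dots,q_{i+1}$; edges $p_mp_{m+1}$ for $0\le m\le i+1$, $q_mp_{m+1}$ for $0\le m\le i$, and $q_mp_m$ for $1\le m\le i+1$. - $S_i$ ($i\ge 1$): vertices $p_0,\dots,p_{i+1}$,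 $q_0,\dots,q_i$, $z$; edges $p_mp_{m+1}$ for $0\le m\le i$, $q_mp_m$ for $0\le m\le i$, $q_mp_{m+1}$ for $0\le m<i$, and $zp_1$, $zq_0$, $zq_1$. - $S_i''$ ($i\ge 2$): the graph $S_i$ together with the edge $zp_2$. - $T_{i,j}$ ($i\ge j\ge 0$): vertices $p_0,\dots,p_{i+1}$, $q_0,\dots,q_i$, $p'_0,\dots,p'_{j+1}$, $q'_0,\dots,q'_j$; edges $p_mp_{m+1}$ and $q_mp_{m+1}$ for $0\le m\le i$, $q_mp_m$ for $1\le m\le i$; likewise $p'_mp'_{m+1}$ and $q'_mp'_{m+1}$ for $0\le m\le j$, $q'_mp'_m$ for $1\le m\le j$; and the three edges $p_{i+1}p'_{j+1}$, $p_{i+1}q'_j$, $q_ip'_{j+1}$. - $G_1$: vertices $0,\dots,5$; edges $01$, $02$, $12$, $03$, $13$, $04$, $14$, $05$, $25$. Let $\mathcal R=\{R_i:i\ge 0\}$, $\mathcal S=\{S_i:i\ge 1\}$, $\mathcal S''=\{S_i'':i\ge 2\}$ and $\mathcal T=\{T_{i,j}:i\ge j\ge 0\}$. **Corollary 3.4.**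 A graph $G$ is a mixed unit interval graph if and only if $G$ is a $\{G_1\}\cup\mathcal R\cup\mathcal S\cup\mathcal S''\cup\mathcal T$-free interval graph. -/

import Mathlib

namespace MixedUnitInterval

open scoped SimpleGraph

/-! ### Intersection representations by intervals of the real line -/

/-- `𝓝` is a family of sets; `G` is an `𝓝`-graph if there is a function `f : V(G) → 𝓝` such that two
distinct vertices are adjacent if and only if their sets have a point in common. -/
def IsIntersectionGraph {α V : Type*} (𝓝 : Set (Set α)) (G : SimpleGraph V) : Prop :=
  ∃ f : V → Set α, (∀ v, f v ∈ 𝓝) ∧ ∀ u v, u ≠ v → (G.Adj u v ↔ (f u ∩ f v).Nonempty)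

/-- The closed, open, open-closed and closed-open intervals of the real line. -/
def intervals : Set (Set ℝ) :=
  {s | ∃ x y : ℝ, s = Set.Icc x y ∨ s = Set.Ioo x y ∨ s = Set.Ioc x y ∨ s = Set.Ico x y}

/-- The closed, open, open-closed and closed-open intervals of length one. -/
def unitIntervals : Set (Set ℝ) :=
  {s | ∃ x : ℝ, s = Set.Icc x (x + 1) ∨ s = Set.Ioo x (x + 1) ∨
    s = Set.Ioc x (x + 1) ∨ s = Set.Ico x (x + 1)}

/-- Interval graphs: the intersection graphs of intervals of the real line. -/
def IsIntervalGraph {V : Type*} (G : SimpleGraph V) : Prop :=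
  IsIntersectionGraph intervals G

/-- Mixed unit interval graphs: closed, open and half-open unit intervals may all be used. -/
def IsMixedUnitIntervalGraph {V : Type*} (G : SimpleGraph V) : Prop :=
  IsIntersectionGraph unitIntervals G

/-! ### Freeness -/

/-- A set of graphs, each on a vertex type of its own. -/
abbrev GraphFamily := Set (Σ W : Type, SimpleGraph W)

/-- `G` is `𝓜`-free if no member of `𝓜` is (isomorphic to) an induced subgraph of `G`. -/
def IsFreeOf {V : Type*} (G : SimpleGraph V) (𝓜 : GraphFamily) : Prop :=
  ∀ H ∈ 𝓜, ¬ H.2 ⊴ G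

/-! ### The forbidden graphs

The vertices of the infinite families lie in two rows. A bottom vertex `p m` is written
`Sum.inl m`, a top vertex `q m` is written `Sum.inr m`. `SimpleGraph.fromRel` makes the
listed relation symmetric. -/

/-- `R i`: a bottom path `p 0, …, p (i + 2)` and top vertices `q 0, …, q (i + 1)`. For `1 ≤ m ≤ i` the
vertices `p m, q m, p (m + 1)` form a triangle, `q 0` is a pendant vertex at `p 1`, and `q (i + 1)` is
a pendant vertex at `p (i + 1)`. In particular `R 0` is the star with four leaves. -/
def graphR (i : ℕ) : SimpleGraph (Fin (i + 3) ⊕ Fin (i + 2)) :=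
  SimpleGraph.fromRel fun a b =>
    match a, b with
    | .inl m, .inl n => n.val = m.val + 1
    | .inr m, .inl n => (n.val = m.val ∧ 1 ≤ m.val) ∨ (n.val = m.val + 1 ∧ m.val ≤ i)
    | _, _ => False

/-- The edges common to `S i` and `S'' i`, without the apex: a bottom path `p 0, …, p (i + 1)` and
top vertices `q 0, …, q i`; for `0 ≤ m < i` the vertices `p m, q m, p (m + 1)` form a triangle, and
`q i` is a pendant vertex at `p i`. -/
def stripS (i : ℕ) : Fin (i + 2) ⊕ Fin (i + 1) → Fin (i + 2) ⊕ Fin (i + 1) → Prop := fun a b =>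
  match a, b with
  | .inl m, .inl n => n.val = m.val + 1
  | .inr m, .inl n => n.val = m.val ∨ (n.val = m.val + 1 ∧ m.val < i)
  | _, _ => False

/-- `S i` (for `i ≥ 1`): the strip together with an apex vertex `none`, which is adjacent to exactly
`p 1`, `q 0` and `q 1`. -/
def graphS (i : ℕ) : SimpleGraph (Option (Fin (i + 2) ⊕ Fin (i + 1))) :=
  SimpleGraph.fromRel fun a b =>
    match a, b with
    | some a, some b => stripS i a b
    | none, some (.inl n) => n.val = 1
    | none, some (.inr n) => n.val = 0 ∨ n.val = 1
    | _, _ => False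

/-- `S'' i` (for `i ≥ 2`): as `S i`, but the apex is also adjacent to `p 2`. -/
def graphS'' (i : ℕ) : SimpleGraph (Option (Fin (i + 2) ⊕ Fin (i + 1))) :=
  SimpleGraph.fromRel fun a b =>
    match a, b with
    | some a, some b => stripS i a b
    | none, some (.inl n) => n.val = 1 ∨ n.val = 2
    | none, some (.inr n) => n.val = 0 ∨ n.val = 1
    | _, _ => False

/-- One of the two halves of `T i j`: a bottom path `p 0, …, p (i + 1)` and top vertices `q 0, …, q i`;
for `1 ≤ m ≤ i` the vertices `p m, q m, p (m + 1)` form a triangle, and `q 0` is a pendant vertex at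
`p 1`. -/
def stripT (i : ℕ) : Fin (i + 2) ⊕ Fin (i + 1) → Fin (i + 2) ⊕ Fin (i + 1) → Prop := fun a b =>
  match a, b with
  | .inl m, .inl n => n.val = m.val + 1
  | .inr m, .inl n => (n.val = m.val ∧ 1 ≤ m.val) ∨ n.val = m.val + 1
  | _, _ => False

/-- `T i j`: two halves with `i` and `j` triangles, with bottom and top vertices `p, q` and `p', q'`
respectively, joined by the three edges `p (i + 1) — p' (j + 1)`, `p (i + 1) — q' j` and
`q i — p' (j + 1)`. -/
def graphT (i j : ℕ) :
    SimpleGraph ((Fin (i + 2) ⊕ Fin (i + 1)) ⊕ (Fin (j + 2) ⊕ Fin (j + 1))) :=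
  SimpleGraph.fromRel fun a b =>
    match a, b with
    | .inl a, .inl b => stripT i a b
    | .inr a, .inr b => stripT j a b
    | .inl (.inl m), .inr (.inl n) => m.val = i + 1 ∧ n.val = j + 1
    | .inl (.inl m), .inr (.inr n) => m.val = i + 1 ∧ n.val = j
    | .inl (.inr m), .inr (.inl n) => m.val = i ∧ n.val = j + 1
    | _, _ => False

/-- `G₁`: adjacent vertices `0, 1` with the three pairwise non-adjacent common neighbours `2, 3, 4`,
and a vertex `5` adjacent to `0` and `2` only. -/
def graphG₁ : SimpleGraph (Fin 6) :=
  SimpleGraph.fromEdgeSet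
    {s(0, 1), s(0, 2), s(1, 2), s(0, 3), s(1, 3), s(0, 4), s(1, 4), s(0, 5), s(2, 5)}

def familyR : GraphFamily := {H | ∃ i : ℕ, H = ⟨_, graphR i⟩}

def familyS : GraphFamily := {H | ∃ i : ℕ, 1 ≤ i ∧ H = ⟨_, graphS i⟩}

def familyS'' : GraphFamily := {H | ∃ i : ℕ, 2 ≤ i ∧ H = ⟨_, graphS'' i⟩}

def familyT : GraphFamily := {H | ∃ i j : ℕ, j ≤ i ∧ H = ⟨_, graphT i j⟩}

end MixedUnitInterval

namespace MixedUnitInterval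

open SimpleGraph

variable {V : Type*} {G : SimpleGraph V}

/-! Necessity. In a mixed unit interval model, left end points less than one apart force adjacency,
more than one apart exclude it, and at distance exactly one the closedness of the two facing ends
decides. Hence the leaves of a claw sit exactly at the centre's place and one unit to either side,
and a strip of triangles hanging on a claw advances exactly one unit per triangle
(`UnitModel.strip`). Each forbidden graph is such a rigid configuration, and its remaining vertices
contradict the rule at distance one.

Sufficiency. A finite interval graph has an integer model in which every integer in the range is
both a left and a right end point (`IsIntervalGraph.exists_canonical`). A properly nested pair
starts a `Strip`. If a strip left a gap after its last top vertex, the vertices starting and ending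
in the gap would complete a forbidden graph (`Strip.gap`). A right-going strip ending at `b` and a
left-going one ending at `b - 1` lead to some `graphT` (`Strip.false_of_opposite`). So nested
intervals, and intervals sharing a locked end, differ by single units (`Tame`).

A corrected centre, `Tame.level`, then ranks the vertices so that such intervals tie. Between two
ranks adjacency is empty, complete, or a product of two subsets (`Ranking`). Placing the ranks
greedily from left to right, at distance more than, less than, or exactly one in these three cases,
and closing just the ends that the partial pairs need, yields the unit model. -/

/-- Distinct and non-adjacent vertices. -/
def Sep (G : SimpleGraph V) (u v : V) : Prop := u ≠ v ∧ ¬ G.Adj u v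

theorem Sep.symm {u v : V} (h : Sep G u v) : Sep G v u :=
  ⟨h.1.symm, fun h' => h.2 h'.symm⟩

/-! ### Necessity: positions and closed ends in a unit model. -/

/-- A mixed unit interval model by left end points `x` and closed ends: `e v 1` says that the
right end of `v` is closed, `e v (-1)` that the left one is. -/
structure UnitModel (G : SimpleGraph V) (x : V → ℝ) (e : V → ℝ → Prop) : Prop where
  near : ∀ {u v}, u ≠ v → |x u - x v| < 1 → G.Adj u v
  far : ∀ {u v}, G.Adj u v → |x u - x v| ≤ 1
  touch : ∀ {u v} {σ : ℝ}, (σ = 1 ∨ σ = -1) → x v = x u + σ → (G.Adj u v ↔ e u σ ∧ e v (-σ))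

theorem IsMixedUnitIntervalGraph.exists_unitModel (h : IsMixedUnitIntervalGraph G) :
    ∃ x e, UnitModel G x e := by
  obtain ⟨f, hf, hadj⟩ := h
  have key : ∀ v, ∃ x : ℝ, (∀ t, x < t → t < x + 1 → t ∈ f v) ∧
      ∀ t ∈ f v, x ≤ t ∧ t ≤ x + 1 := by
    intro v
    obtain ⟨x, h | h | h | h⟩ := hf v <;> refine ⟨x, ?_, ?_⟩ <;> rw [h] <;> intro t <;>
      simp only [Set.mem_Icc, Set.mem_Ioo, Set.mem_Ioc, Set.mem_Ico] <;> intros <;>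
      constructor <;> linarith
  choose x hin hout using key
  have near : ∀ u v, x u ≤ x v → x v < x u + 1 → (f u ∩ f v).Nonempty := by
    intro u v h1 h2
    exact ⟨(x v + x u + 1) / 2, hin _ _ (by linarith) (by linarith),
      hin _ _ (by linarith) (by linarith)⟩
  have touch : ∀ u v, x v = x u + 1 →
      ((f u ∩ f v).Nonempty ↔ x u + 1 ∈ f u ∧ x v ∈ f v) := by
    intro u v h
    constructor
    · rintro ⟨t, ht1, ht2⟩
      have e1 : t = x v := le_antisymm (by linarith [(hout _ _ ht1).2]) (hout _ _ ht2).1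
      rw [← h]
      exact ⟨e1 ▸ ht1, e1 ▸ ht2⟩
    · rintro ⟨h1, h2⟩
      exact ⟨x v, by rw [h]; exact h1, h2⟩
  refine ⟨x, fun v σ => x v + (1 + σ) / 2 ∈ f v, ?_, ?_, ?_⟩
  · intro u v huv h
    rw [abs_lt] at h
    rw [hadj u v huv]
    rcases le_total (x u) (x v) with h' | h'
    · exact near u v h' (by linarith)
    · rw [Set.inter_comm]
      exact near v u h' (by linarith)
  · intro u v h
    obtain ⟨t, ht1, ht2⟩ := (hadj u v h.ne).1 h
    have := hout _ _ ht1
    have := hout _ _ ht2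
    rw [abs_le]
    constructor <;> linarith
  · rintro u v σ (rfl | rfl) h
    · have huv : u ≠ v := by rintro rfl; linarith
      rw [hadj u v huv, touch u v h]
      norm_num
    · have huv : u ≠ v := by rintro rfl; linarith
      rw [hadj u v huv, Set.inter_comm, touch v u (by linarith)]
      norm_num
      tauto

namespace UnitModel

variable {x : V → ℝ} {e : V → ℝ → Prop}

theorem comap (h : UnitModel G x e) {W : Type*} {H : SimpleGraph W} (f : H ↪g G) :
    UnitModel H (x ∘ f) (fun w => e (f w)) where
  near {u v} huv hx := f.map_adj_iff.1 (h.near (f.injective.ne huv) hx)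
  far {u v} huv := h.far (f.map_adj_iff.2 huv)
  touch {u v σ} hσ hx := by rw [← f.map_adj_iff]; exact h.touch hσ hx

theorem one_le (h : UnitModel G x e) {u v : V} (huv : Sep G u v) : 1 ≤ |x u - x v| := by
  by_contra hc
  exact huv.2 (h.near huv.1 (not_le.1 hc))

theorem not_same (h : UnitModel G x e) {u v : V} (huv : Sep G u v) : x u ≠ x v := by
  intro hx
  have := h.one_le huv
  simp [hx] at this
  linarith

/-- The leaves lie within one unit of the centre and are pairwise at least one unit apart, which
leaves only the places `x c - 1`, `x c`, `x c + 1`. The sign `σ` stands for the orientation, so that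
mirror images need no separate treatment. -/
theorem claw (h : UnitModel G x e) {c a b d : V} (ha : G.Adj c a) (hb : G.Adj c b)
    (hd : G.Adj c d) (hab : Sep G a b) (had : Sep G a d) (hbd : Sep G b d) :
    ∃ σ : ℝ, (σ = 1 ∨ σ = -1) ∧
      ((x a = x c ∧ x b = x c - σ ∧ x d = x c + σ) ∨ (x b = x c ∧ x a = x c - σ ∧ x d = x c + σ) ∨
        (x d = x c ∧ x a = x c - σ ∧ x b = x c + σ)) := by
  have h1 := abs_le.1 (h.far ha)
  have h2 := abs_le.1 (h.far hb)
  have h3 := abs_le.1 (h.far hd)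
  rcases le_abs.1 (h.one_le hab) with h4 | h4 <;> rcases le_abs.1 (h.one_le had) with h5 | h5 <;>
    rcases le_abs.1 (h.one_le hbd) with h6 | h6
  · exact ⟨-1, .inr rfl, .inr (.inl ⟨by linarith, by linarith, by linarith⟩)⟩
  · exact ⟨-1, .inr rfl, .inr (.inr ⟨by linarith, by linarith, by linarith⟩)⟩
  · exact absurd h6 (by linarith)
  · exact ⟨1, .inl rfl, .inl ⟨by linarith, by linarith, by linarith⟩⟩
  · exact ⟨-1, .inr rfl, .inl ⟨by linarith, by linarith, by linarith⟩⟩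
  · exact absurd h6 (by linarith)
  · exact ⟨1, .inl rfl, .inr (.inr ⟨by linarith, by linarith, by linarith⟩)⟩
  · exact ⟨1, .inl rfl, .inr (.inl ⟨by linarith, by linarith, by linarith⟩)⟩

theorem closed_of_adj (h : UnitModel G x e) {u v : V} (huv : G.Adj u v) {σ : ℝ}
    (hσ : σ = 1 ∨ σ = -1) (hx : x v = x u + σ) : e u σ ∧ e v (-σ) :=
  (h.touch hσ hx).1 huv

/-- A vertex adjacent to exactly one of two vertices at the same place sits one unit away. -/
theorem advance (h : UnitModel G x e) {o p q v : V} {σ : ℝ} (hσ : σ = 1 ∨ σ = -1)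
    (hp : x p = x o + σ) (hq : x q = x o + σ) (hpv : G.Adj p v) (hqv : Sep G v q)
    (hov : Sep G v o) : x v = x o + 2 * σ ∧ e v (-σ) := by
  have h1 := abs_le.1 (h.far hpv)
  have h3 : x v = x o + 2 * σ := by
    have h4 := h.not_same hov
    rcases hσ with rfl | rfl <;> rcases le_abs.1 (h.one_le hqv) with h2 | h2
    · linarith
    · exact absurd (by linarith) h4
    · exact absurd (by linarith) h4
    · linarith
  exact ⟨h3, (h.closed_of_adj hpv hσ (by linarith)).2⟩

/-- The middle leaf of a claw has no neighbours besides those of the centre. -/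
theorem adj_of_middle (h : UnitModel G x e) {c a b d v : V} {σ : ℝ} (hσ : σ = 1 ∨ σ = -1)
    (ha : x a = x c) (hb : x b = x c - σ) (hd : x d = x c + σ) (hcb : G.Adj c b)
    (hcd : G.Adj c d) (hvc : v ≠ c) (hav : G.Adj a v) : G.Adj c v := by
  have h1 := h.far hav
  rw [ha] at h1
  rcases h1.lt_or_eq with h1 | h1
  · exact h.near hvc.symm h1
  -- The outer leaves touch `c` at its two ends, so both ends of `c` are closed, and `c` touches
  -- whatever `a` touches.
  have hb' := h.closed_of_adj hcb (σ := -σ) (by rcases hσ with rfl | rfl <;> simp) (by linarith)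
  have hd' := h.closed_of_adj hcd hσ hd
  rcases (abs_eq zero_le_one).1 h1 with h2 | h2
  · have hx : x v = x c + -1 := by linarith
    have hv := h.closed_of_adj hav (.inr rfl) (by linarith)
    refine (h.touch (.inr rfl) hx).2 ⟨?_, hv.2⟩
    rcases hσ with rfl | rfl
    · exact hb'.1
    · exact hd'.1
  · have hx : x v = x c + 1 := by linarith
    have hv := h.closed_of_adj hav (.inl rfl) (by linarith)
    refine (h.touch (.inl rfl) hx).2 ⟨?_, hv.2⟩
    rcases hσ with rfl | rfl
    · exact hd'.1
    · simpa using hb'.1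

end UnitModel

/-! ### Necessity: strips of triangles and the forbidden graphs. -/

/-- A strip of triangles `p k, p (k + 1), q (k + 1)` for `k < n`, with leaves `l` and `q 0`
attached to `p 0`. -/
structure TriStrip (G : SimpleGraph V) (n : ℕ) (l : V) (p q : ℕ → V) : Prop where
  adj_l : G.Adj (p 0) l
  adj_q : ∀ k ≤ n, G.Adj (p k) (q k)
  adj_pp : ∀ k < n, G.Adj (p k) (p (k + 1))
  adj_pq : ∀ k < n, G.Adj (p k) (q (k + 1))
  sep_l : Sep G l (q 0)
  sep_lp : 0 < n → Sep G l (p 1)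
  sep_lq : 0 < n → Sep G l (q 1)
  sep_qp : ∀ k < n, Sep G (q k) (p (k + 1))
  sep_qq : ∀ k < n, Sep G (q k) (q (k + 1))
  sep_pp : ∀ k, k + 1 < n → Sep G (p k) (p (k + 2))
  sep_pq : ∀ k, k + 1 < n → Sep G (p k) (q (k + 2))

theorem TriStrip.mono {n : ℕ} {l : V} {p q : ℕ → V} (s : TriStrip G (n + 1) l p q) :
    TriStrip G n l p q where
  adj_l := s.adj_l
  adj_q k hk := s.adj_q k (by omega)
  adj_pp k hk := s.adj_pp k (by omega)
  adj_pq k hk := s.adj_pq k (by omega)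
  sep_l := s.sep_l
  sep_lp hk := s.sep_lp (by omega)
  sep_lq hk := s.sep_lq (by omega)
  sep_qp k hk := s.sep_qp k (by omega)
  sep_qq k hk := s.sep_qq k (by omega)
  sep_pp k hk := s.sep_pp k (by omega)
  sep_pq k hk := s.sep_pq k (by omega)

/-- In a unit model a strip of triangles advances by exactly one unit per triangle. -/
theorem UnitModel.strip {x : V → ℝ} {e : V → ℝ → Prop} (h : UnitModel G x e) {l : V}
    {p q : ℕ → V} (n : ℕ) (s : TriStrip G (n + 1) l p q)
    (hv : ∃ v, G.Adj (p (n + 1)) v ∧ Sep G v (q (n + 1)) ∧ Sep G v (p n)) :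
    ∃ σ : ℝ, (σ = 1 ∨ σ = -1) ∧ x (p (n + 1)) = x (p n) + σ ∧ x (q (n + 1)) = x (p n) + σ ∧
      e (q (n + 1)) (-σ) ∧
      ∀ v, G.Adj (p (n + 1)) v → Sep G v (q (n + 1)) → Sep G v (p n) →
        x v = x (p n) + 2 * σ ∧ e v (-σ) := by
  induction n with
  | zero =>
    suffices H : ∃ σ : ℝ, (σ = 1 ∨ σ = -1) ∧ x (p 1) = x (p 0) + σ ∧ x (q 1) = x (p 0) + σ by
      obtain ⟨σ, hσ, h1, h2⟩ := H
      exact ⟨σ, hσ, h1, h2, (h.closed_of_adj (s.adj_pq 0 (by omega)) hσ h2).2,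
        fun v h3 h4 h5 => h.advance hσ h1 h2 h3 h4 h5⟩
    have hq := s.adj_q 0 (by omega)
    have hlp := s.sep_lp (by omega)
    have hlq := s.sep_lq (by omega)
    have hqp := s.sep_qp 0 (by omega)
    have hqq := s.sep_qq 0 (by omega)
    have hp1 := s.adj_pp 0 (by omega)
    have hq1 := s.adj_pq 0 (by omega)
    have near := abs_le.1 (h.far (s.adj_q 1 (by omega)))
    obtain ⟨σ, hσ, h1 | h1 | h1⟩ := h.claw s.adj_l hq hp1 s.sep_l hlp hqp
    · refine ⟨σ, hσ, h1.2.2, ?_⟩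
      -- The two claws share the leaves `l` and `q 0`; their places force `τ = σ` and send `q 1` to
      -- the place of `p 1`.
      obtain ⟨τ, hτ, h2 | h2 | h2⟩ := h.claw s.adj_l hq hq1 s.sep_l hlq hqq <;>
        rcases hσ with rfl | rfl <;> rcases hτ with rfl | rfl <;> linarith
    · refine ⟨σ, hσ, h1.2.2, ?_⟩
      obtain ⟨τ, hτ, h2 | h2 | h2⟩ := h.claw s.adj_l hq hq1 s.sep_l hlq hqq <;>
        rcases hσ with rfl | rfl <;> rcases hτ with rfl | rfl <;> linarith
    -- `p 1` cannot be the middle leaf, since it has a neighbour `v` missed by the centre `p 0`.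
    · obtain ⟨v, hv1, -, hv2⟩ := hv
      exact absurd (h.adj_of_middle hσ h1.1 h1.2.1 h1.2.2 s.adj_l hq hv2.1 hv1).symm hv2.2
  | succ n ih =>
    have a1 := s.adj_pp (n + 1) (by omega)
    have a2 := s.adj_pq (n + 1) (by omega)
    have s1 := (s.sep_qp (n + 1) (by omega)).symm
    have s2 := (s.sep_qq (n + 1) (by omega)).symm
    have s3 := (s.sep_pp n (by omega)).symm
    have s4 := (s.sep_pq n (by omega)).symm
    obtain ⟨σ, hσ, h1, -, -, h2⟩ := ih s.mono ⟨_, a1, s1, s3⟩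
    obtain ⟨h3, -⟩ := h2 _ a1 s1 s3
    obtain ⟨h4, h5⟩ := h2 _ a2 s2 s4
    have h6 : x (p (n + 1 + 1)) = x (p (n + 1)) + σ := by linarith
    have h7 : x (q (n + 1 + 1)) = x (p (n + 1)) + σ := by linarith
    exact ⟨σ, hσ, h6, h7, h5, fun v h8 h9 h10 => h.advance hσ h6 h7 h8 h9 h10⟩

theorem UnitModel.false_of_star {x : V → ℝ} {e : V → ℝ → Prop} (h : UnitModel G x e)
    {c a b d f : V} (ha : G.Adj c a) (hb : G.Adj c b) (hd : G.Adj c d) (hf : G.Adj c f)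
    (hab : Sep G a b) (had : Sep G a d) (hbd : Sep G b d) (haf : Sep G a f) (hbf : Sep G b f)
    (hdf : Sep G d f) : False := by
  have h1 := abs_le.1 (h.far hf)
  have h2 := h.one_le haf
  have h3 := h.one_le hbf
  have h4 := h.one_le hdf
  obtain ⟨σ, hσ, h5⟩ := h.claw ha hb hd hab had hbd
  rcases le_abs.1 h2 with h2 | h2 <;> rcases le_abs.1 h3 with h3 | h3 <;>
    rcases le_abs.1 h4 with h4 | h4 <;> rcases hσ with rfl | rfl <;>
    obtain h5 | h5 | h5 := h5 <;> linarith

theorem not_unitModel_graphR (i : ℕ) (x : _ → ℝ) (e : _ → ℝ → Prop) :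
    ¬ UnitModel (graphR i) x e := by
  intro h
  rcases i with _ | n
  · refine h.false_of_star (c := .inl 1) (a := .inl 0) (b := .inl 2) (d := .inr 0) (f := .inr 1)
      ?_ ?_ ?_ ?_ ?_ ?_ ?_ ?_ ?_ ?_ <;> simp [graphR, Sep]
  · let P : ℕ → Fin (n + 1 + 3) ⊕ Fin (n + 1 + 2) := fun k => .inl ⟨min (k + 1) (n + 3), by omega⟩
    let Q : ℕ → Fin (n + 1 + 3) ⊕ Fin (n + 1 + 2) := fun k => .inr ⟨min k (n + 2), by omega⟩
    have s : TriStrip (graphR (n + 1)) (n + 1) (.inl 0) P Q := by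
      constructor <;> intros <;> simp [graphR, Sep, P, Q] <;> omega
    have a1 : (graphR (n + 1)).Adj (P (n + 1)) (P (n + 2)) := by
      simp [graphR, P]
    have a2 : (graphR (n + 1)).Adj (P (n + 1)) (Q (n + 2)) := by
      simp [graphR, P, Q]
    have s1 : Sep (graphR (n + 1)) (P (n + 2)) (Q (n + 1)) := by
      simp [graphR, P, Q, Sep]
    have s2 : Sep (graphR (n + 1)) (Q (n + 2)) (Q (n + 1)) := by
      simp [graphR, Q, Sep]
    have s3 : Sep (graphR (n + 1)) (P (n + 2)) (P n) := by
      simp [graphR, P, Sep]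
    have s4 : Sep (graphR (n + 1)) (Q (n + 2)) (P n) := by
      simp [graphR, P, Q, Sep]
    have s5 : Sep (graphR (n + 1)) (P (n + 2)) (Q (n + 2)) := by
      simp [graphR, P, Q, Sep]
    -- The two vertices beyond the strip are sent to the same place although they are not adjacent.
    obtain ⟨σ, -, -, -, -, hv⟩ := h.strip n s ⟨_, a1, s1, s3⟩
    exact h.not_same s5 ((hv _ a1 s1 s3).1.trans (hv _ a2 s2 s4).1.symm)

/-- Vertices one unit past `y` with equal left ends cannot be told apart by a neighbour of `q`. -/
theorem UnitModel.false_of_apex {x : V → ℝ} {e : V → ℝ → Prop} (h : UnitModel G x e)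
    {q v w z : V} {σ y : ℝ} (hσ : σ = 1 ∨ σ = -1) (hq : x q = y ∨ x q = y - σ)
    (hv : x v = y + σ) (hev : e v (-σ)) (hw : x w = y + σ)
    (hzq : G.Adj z q) (hzw : G.Adj z w) (hzv : Sep G z v) : False := by
  have h1 := abs_le.1 (h.far hzq)
  have h2 := abs_le.1 (h.far hzw)
  have h3 := h.one_le hzv
  -- `z` is exactly one unit from the common place of `v` and `w`, and the place `y + 2 * σ` is too
  -- far from `q`.
  have h4 : x z = y := by
    rcases hσ with rfl | rfl <;> rcases hq with hq | hq <;> rcases le_abs.1 h3 with h3 | h3 <;>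
      linarith
  have h5 := h.closed_of_adj hzw hσ (by linarith)
  exact hzv.2 ((h.touch hσ (by linarith)).2 ⟨h5.1, hev⟩)

/-- `v` and `w` extend the strip and land at the same place, but the apex `z` distinguishes them.
Nothing is said about `z` and the bottom vertices, so the lemma serves both `graphS` and `graphS''`.
-/
theorem UnitModel.false_of_strip_apex {x : V → ℝ} {e : V → ℝ → Prop} (h : UnitModel G x e)
    {n : ℕ} {l v w z : V} {p q : ℕ → V} (s : TriStrip G n l p q)
    (apv : G.Adj (p n) v) (apw : G.Adj (p n) w) (sqv : Sep G v (q n)) (sqw : Sep G w (q n))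
    (spv : ∀ k, k + 1 = n → Sep G v (p k)) (spw : ∀ k, k + 1 = n → Sep G w (p k))
    (slv : n = 0 → Sep G v l) (slw : n = 0 → Sep G w l)
    (azw : G.Adj z w) (azq : G.Adj z (q n)) (szv : Sep G z v)
    (avw : G.Adj v w) : False := by
  rcases n with _ | n
  · have lv := (slv rfl).symm
    have lw := (slw rfl).symm
    have apl := s.adj_l
    have apq := s.adj_q 0 le_rfl
    obtain ⟨σ, hσ, h1⟩ := h.claw apl apq apv s.sep_l lv sqv.symm
    obtain ⟨τ, hτ, h2⟩ := h.claw apl apq apw s.sep_l lw sqw.symm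
    have near := abs_le.1 (h.far avw)
    have hvw : x w = x v := by
      rcases hσ with rfl | rfl <;> rcases hτ with rfl | rfl <;> obtain h1 | h1 | h1 := h1 <;>
      obtain h2 | h2 | h2 := h2 <;> linarith
    obtain h1 | h1 | h1 := h1
    · exact h.false_of_apex hσ (.inr h1.2.1) h1.2.2 (h.closed_of_adj apv hσ h1.2.2).2
        (hvw.trans h1.2.2) azq azw szv
    · exact h.false_of_apex hσ (.inl h1.1) h1.2.2 (h.closed_of_adj apv hσ h1.2.2).2
        (hvw.trans h1.2.2) azq azw szv
    -- Now `v` is the middle leaf, and `z` lies at the place of `q 0` or of `l`. Touching `z` makes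
    -- `w` closed on that side, and the leaf there is closed towards `p 0`, so `w` would be adjacent
    -- to that leaf.
    · have h3 := h.one_le szv
      have h4 := abs_le.1 (h.far azw)
      have key : ∀ τ t, (τ = 1 ∨ τ = -1) → x z = x w + τ → x t = x w + τ → G.Adj (p 0) t →
          Sep G w t → False := by
        intro τ t hτ hz ht hpt hwt
        refine hwt.2 ((h.touch hτ ht).2 ⟨(h.closed_of_adj azw.symm hτ hz).1,
          (h.closed_of_adj hpt hτ (by linarith)).2⟩)
      have hz : x z = x w + σ ∨ x z = x w + -σ := by
        rcases hσ with rfl | rfl <;> rcases le_abs.1 h3 with h3 | h3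
        · exact .inl (by linarith)
        · exact .inr (by linarith)
        · exact .inr (by linarith)
        · exact .inl (by linarith)
      rcases hz with hz | hz
      · exact key σ (q 0) hσ hz (by linarith) apq sqw
      · exact key (-σ) l (by rcases hσ with rfl | rfl <;> simp) hz (by linarith) apl lw.symm
  · have b1 := spv n rfl
    have b2 := spw n rfl
    obtain ⟨σ, hσ, -, h2, -, hv⟩ := h.strip n s ⟨_, apv, sqv, b1⟩
    obtain ⟨h3, h4⟩ := hv _ apv sqv b1
    exact h.false_of_apex (y := x (p n) + σ) hσ (.inl h2) (by linarith) h4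
      (by linarith [(hv _ apw sqw b2).1]) azq azw szv

/-- The claw at one end of `T i j`, seen from the other half of the graph. -/
theorem UnitModel.false_of_strip_strip {x : V → ℝ} {e : V → ℝ → Prop} (h : UnitModel G x e)
    {n m : ℕ} {l l' : V} {p q p' q' : ℕ → V} (s : TriStrip G n l p q) (s' : TriStrip G m l' p' q')
    (hmn : m ≤ n) (apq : G.Adj (p n) (q' m)) (aqp : G.Adj (p' m) (q n)) (sqq : Sep G (q n) (q' m))
    (sp : ∀ k, k + 1 = n → Sep G (q' m) (p k)) (sp' : ∀ k, k + 1 = m → Sep G (q n) (p' k))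
    (sl : n = 0 → Sep G l (q' m)) (sl' : m = 0 → Sep G l' (q n)) (slp : n = 0 → Sep G l (p' m)) :
    False := by
  rcases m with _ | m
  · obtain ⟨τ, hτ, h'⟩ := h.claw s'.adj_l (s'.adj_q 0 le_rfl) aqp s'.sep_l (sl' rfl) sqq.symm
    have apl := s.adj_l
    have apl' := s'.adj_l
    have apq' := s'.adj_q 0 le_rfl
    have touch : ∀ {a b c d : V} {σ : ℝ}, (σ = 1 ∨ σ = -1) → G.Adj a d → G.Adj c b →
        x d = x a + σ → x b = x c + σ → x a = x c → G.Adj a b := by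
      intro a b c d σ hσ h1 h2 h3 h4 h5
      exact (h.touch hσ (by linarith)).2
        ⟨(h.closed_of_adj h1 hσ h3).1, (h.closed_of_adj h2 hσ h4).2⟩
    have neg : ∀ {σ : ℝ}, (σ = 1 ∨ σ = -1) → -σ = 1 ∨ -σ = -1 := by
      rintro σ (rfl | rfl) <;> simp
    rcases n with _ | n
    · obtain ⟨σ, hσ, h1⟩ := h.claw apl (s.adj_q 0 le_rfl) apq s.sep_l (sl rfl) sqq
      have near := abs_le.1 (h.far aqp)
      have near' := abs_le.1 (h.far apq')
      have lp := slp rfl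
      obtain h1 | h1 | h1 := h1
      · refine lp.2 (h.near lp.1 ?_)
        have : x (p' 0) = x l := by rcases hσ with rfl | rfl <;> linarith
        simp [this]
      · obtain h2 | h2 | h2 := h'
        · rcases hσ with rfl | rfl <;> rcases hτ with rfl | rfl <;> linarith
        · exact sqq.2 (touch hσ aqp.symm apq (by linarith) h1.2.2 h1.1)
        · have : τ = σ := by linarith
          subst this
          exact lp.2 (touch (neg hσ) apl' apl (by linarith) (by linarith) (by linarith)).symm
      · obtain h2 | h2 | h2 := h'
        · rcases hσ with rfl | rfl <;> rcases hτ with rfl | rfl <;> linarith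
        · have : τ = σ := by linarith
          subst this
          exact lp.2 (touch (neg hσ) apl' apl (by linarith) (by linarith) (by linarith)).symm
        · exact sqq.2 (touch hσ apq'.symm (s.adj_q 0 le_rfl) (by linarith) h1.2.2 h1.1).symm
    · obtain ⟨σ, hσ, h1, h2, h3, hv⟩ := h.strip n s ⟨_, apq, sqq.symm, sp n rfl⟩
      obtain ⟨h4, h5⟩ := hv _ apq sqq.symm (sp n rfl)
      obtain h6 | h6 | h6 := h'
      · rcases hσ with rfl | rfl <;> rcases hτ with rfl | rfl <;> linarith
      · exact sqq.2 ((h.touch hσ (by linarith)).2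
          ⟨(h.closed_of_adj aqp.symm hσ (by linarith)).1, h5⟩)
      · have : τ = σ := by linarith
        subst this
        have h7 := (h.closed_of_adj apl' (neg hσ) (by linarith)).2
        exact (sl' rfl).symm.2 ((h.touch (neg hσ) (by linarith)).2 ⟨h3, h7⟩)
  · obtain ⟨n, rfl⟩ : ∃ k, n = k + 1 := ⟨n - 1, by omega⟩
    obtain ⟨σ, hσ, h1, h2, h3, hv⟩ := h.strip n s ⟨_, apq, sqq.symm, sp n rfl⟩
    obtain ⟨τ, hτ, k1, k2, k3, kv⟩ := h.strip m s' ⟨_, aqp, sqq, sp' m rfl⟩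
    obtain ⟨h4, h5⟩ := hv _ apq sqq.symm (sp n rfl)
    obtain ⟨k4, k5⟩ := kv _ aqp sqq (sp' m rfl)
    -- Each half determines the signed displacement between `q (n + 1)` and `q' (m + 1)`; comparing
    -- the two shows that the halves run towards each other. The facing ends are then closed, which
    -- makes these vertices adjacent.
    have hτσ : τ = -σ := by linarith
    subst hτσ
    rw [neg_neg] at k5
    exact sqq.2 ((h.touch hσ (by linarith)).2 ⟨k5, h5⟩)

/-- Membership in an explicit list can be settled by `decide`. -/
theorem graphG₁_adj (a b : Fin 6) : graphG₁.Adj a b ↔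
    s(a, b) ∈ [s((0 : Fin 6), (1 : Fin 6)), s(0, 2), s(1, 2), s(0, 3), s(1, 3), s(0, 4), s(1, 4),
      s(0, 5), s(2, 5)] := by
  have ne : ∀ a b : Fin 6, s(a, b) ∈ [s((0 : Fin 6), (1 : Fin 6)), s(0, 2), s(1, 2), s(0, 3),
      s(1, 3), s(0, 4), s(1, 4), s(0, 5), s(2, 5)] → a ≠ b := by decide
  refine Iff.trans ?_ (and_iff_left_of_imp (ne a b))
  simp only [graphG₁, SimpleGraph.fromEdgeSet_adj, Set.mem_insert_iff, Set.mem_singleton_iff,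
    List.mem_cons, List.not_mem_nil, or_false]

theorem not_unitModel_graphG₁ (x : _ → ℝ) (e : _ → ℝ → Prop) : ¬ UnitModel graphG₁ x e := by
  intro h
  have a : ∀ c b : Fin 6, c ≤ 1 → 2 ≤ b → b ≤ 4 → graphG₁.Adj c b := by
    simp only [graphG₁_adj]; decide
  have s : ∀ b c : Fin 6, 2 ≤ b → b ≤ 4 → 2 ≤ c → c ≤ 4 → b ≠ c → Sep graphG₁ b c := by
    simp only [graphG₁_adj, Sep]; decide
  have a05 : graphG₁.Adj 0 5 := by simp only [graphG₁_adj]; decide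
  have s15 : Sep graphG₁ 1 5 := by simp only [graphG₁_adj, Sep]; decide
  -- Whichever leaf is in the middle, the places of the leaves sum to three times that of the
  -- centre. Hence `0` and `1` share a place, and `5` lies one unit away, where a leaf shows that
  -- the end of `1` is closed.
  have key : ∀ c, c ≤ 1 → ∃ σ : ℝ, (σ = 1 ∨ σ = -1) ∧ ∃ b d, 2 ≤ b ∧ b ≤ 4 ∧ 2 ≤ d ∧ d ≤ 4 ∧
      x b = x c + σ ∧ x d = x c + -σ ∧ x 2 + x 3 + x 4 = 3 * x c := by
    intro c hc
    obtain ⟨σ, hσ, h1 | h1 | h1⟩ := h.claw (a c 2 hc (by decide) (by decide))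
      (a c 3 hc (by decide) (by decide)) (a c 4 hc (by decide) (by decide))
      (s 2 3 (by decide) (by decide) (by decide) (by decide) (by decide))
      (s 2 4 (by decide) (by decide) (by decide) (by decide) (by decide))
      (s 3 4 (by decide) (by decide) (by decide) (by decide) (by decide))
    · exact ⟨σ, hσ, 4, 3, by decide, by decide, by decide, by decide, h1.2.2, by linarith,
        by linarith⟩
    · exact ⟨σ, hσ, 4, 2, by decide, by decide, by decide, by decide, h1.2.2, by linarith,
        by linarith⟩
    · exact ⟨σ, hσ, 3, 2, by decide, by decide, by decide, by decide, h1.2.2, by linarith,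
        by linarith⟩
  obtain ⟨σ, hσ, b, d, hb, hb', hd, hd', xb, xd, h1⟩ := key 1 le_rfl
  obtain ⟨-, -, -, -, -, -, -, -, -, -, h0⟩ := key 0 (by decide)
  have hx : x 1 = x 0 := by linarith
  have h2 := abs_le.1 (h.far a05)
  have h3 := h.one_le s15
  have touch : ∀ τ t, (τ = 1 ∨ τ = -1) → 2 ≤ t → t ≤ 4 → x 5 = x 1 + τ → x t = x 1 + τ →
      False := fun τ t hτ ht ht' h5 hxt =>
    s15.2 ((h.touch hτ h5).2 ⟨(h.closed_of_adj (a 1 t le_rfl ht ht') hτ hxt).1,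
      (h.closed_of_adj a05 hτ (by linarith)).2⟩)
  have hz : x 5 = x 1 + σ ∨ x 5 = x 1 + -σ := by
    rcases hσ with rfl | rfl <;> rcases le_abs.1 h3 with h3 | h3
    · exact .inr (by linarith)
    · exact .inl (by linarith)
    · exact .inl (by linarith)
    · exact .inr (by linarith)
  rcases hz with hz | hz
  · exact touch σ b hσ hb hb' hz xb
  · exact touch (-σ) d (by rcases hσ with rfl | rfl <;> simp) hd hd' hz xd

theorem not_unitModel_graphS (i : ℕ) (hi : 1 ≤ i) (x : _ → ℝ) (e : _ → ℝ → Prop) :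
    ¬ UnitModel (graphS i) x e := by
  intro h
  obtain ⟨n, rfl⟩ : ∃ n, i = n + 1 := ⟨i - 1, by omega⟩
  -- The strip is read backwards, from the claw at `p (n + 1)` towards the apex.
  let P : ℕ → Option (Fin (n + 1 + 2) ⊕ Fin (n + 1 + 1)) :=
    fun k => some (.inl ⟨n + 1 - k, by omega⟩)
  let Q : ℕ → Option (Fin (n + 1 + 2) ⊕ Fin (n + 1 + 1)) :=
    fun k => some (.inr ⟨n + 1 - k, by omega⟩)
  have s : TriStrip (graphS (n + 1)) n (some (.inl ⟨n + 2, by omega⟩)) P Q := by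
    constructor <;> intros <;> simp [graphS, stripS, Sep, P, Q] <;> omega
  refine h.false_of_strip_apex s (v := some (.inl 0)) (w := some (.inr 0)) (z := none)
    ?_ ?_ ?_ ?_ ?_ ?_ ?_ ?_ ?_ ?_ ?_ ?_ <;> intros <;> simp [graphS, stripS, Sep, P, Q] <;> omega

theorem not_unitModel_graphS'' (i : ℕ) (hi : 2 ≤ i) (x : _ → ℝ) (e : _ → ℝ → Prop) :
    ¬ UnitModel (graphS'' i) x e := by
  intro h
  obtain ⟨n, rfl⟩ : ∃ n, i = n + 1 := ⟨i - 1, by omega⟩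
  let P : ℕ → Option (Fin (n + 1 + 2) ⊕ Fin (n + 1 + 1)) :=
    fun k => some (.inl ⟨n + 1 - k, by omega⟩)
  let Q : ℕ → Option (Fin (n + 1 + 2) ⊕ Fin (n + 1 + 1)) :=
    fun k => some (.inr ⟨n + 1 - k, by omega⟩)
  have s : TriStrip (graphS'' (n + 1)) n (some (.inl ⟨n + 2, by omega⟩)) P Q := by
    constructor <;> intros <;> simp [graphS'', stripS, Sep, P, Q] <;> omega
  refine h.false_of_strip_apex s (v := some (.inl 0)) (w := some (.inr 0)) (z := none)
    ?_ ?_ ?_ ?_ ?_ ?_ ?_ ?_ ?_ ?_ ?_ ?_ <;> intros <;> simp [graphS'', stripS, Sep, P, Q] <;> omega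

theorem not_unitModel_graphT (i j : ℕ) (hij : j ≤ i) (x : _ → ℝ) (e : _ → ℝ → Prop) :
    ¬ UnitModel (graphT i j) x e := by
  intro h
  let P : ℕ → (Fin (i + 2) ⊕ Fin (i + 1)) ⊕ (Fin (j + 2) ⊕ Fin (j + 1)) :=
    fun k => .inl (.inl ⟨min (k + 1) (i + 1), by omega⟩)
  let Q : ℕ → (Fin (i + 2) ⊕ Fin (i + 1)) ⊕ (Fin (j + 2) ⊕ Fin (j + 1)) :=
    fun k => .inl (.inr ⟨min k i, by omega⟩)
  let P' : ℕ → (Fin (i + 2) ⊕ Fin (i + 1)) ⊕ (Fin (j + 2) ⊕ Fin (j + 1)) :=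
    fun k => .inr (.inl ⟨min (k + 1) (j + 1), by omega⟩)
  let Q' : ℕ → (Fin (i + 2) ⊕ Fin (i + 1)) ⊕ (Fin (j + 2) ⊕ Fin (j + 1)) :=
    fun k => .inr (.inr ⟨min k j, by omega⟩)
  have s : TriStrip (graphT i j) i (.inl (.inl 0)) P Q := by
    constructor <;> intros <;> simp [graphT, stripT, Sep, P, Q] <;> omega
  have s' : TriStrip (graphT i j) j (.inr (.inl 0)) P' Q' := by
    constructor <;> intros <;> simp [graphT, stripT, Sep, P', Q'] <;> omega
  refine h.false_of_strip_strip s s' hij ?_ ?_ ?_ ?_ ?_ ?_ ?_ ?_ <;> intros <;>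
    simp [graphT, stripT, Sep, P, Q, P', Q'] <;> omega

theorem IsMixedUnitIntervalGraph.isFreeOf (h : IsMixedUnitIntervalGraph G) :
    IsFreeOf G ({⟨Fin 6, graphG₁⟩} ∪ familyR ∪ familyS ∪ familyS'' ∪ familyT) := by
  obtain ⟨x, e, h⟩ := h.exists_unitModel
  rintro H ((((rfl | ⟨i, rfl⟩) | ⟨i, hi, rfl⟩) | ⟨i, hi, rfl⟩) | ⟨i, j, hij, rfl⟩) ⟨f⟩
  · exact not_unitModel_graphG₁ _ _ (h.comap f)
  · exact not_unitModel_graphR _ _ _ (h.comap f)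
  · exact not_unitModel_graphS _ hi _ _ (h.comap f)
  · exact not_unitModel_graphS'' _ hi _ _ (h.comap f)
  · exact not_unitModel_graphT _ _ hij _ _ (h.comap f)

/-! ### Interval models with integer end points. -/

theorem IsMixedUnitIntervalGraph.isIntervalGraph (h : IsMixedUnitIntervalGraph G) :
    IsIntervalGraph G := by
  obtain ⟨f, hf, h⟩ := h
  refine ⟨f, fun v => ?_, h⟩
  obtain ⟨x, hx⟩ := hf v
  exact ⟨x, x + 1, hx.imp_right (Or.imp_right (Or.imp_left id))⟩

theorem ordConnected_of_mem_intervals {s : Set ℝ} (hs : s ∈ intervals) : s.OrdConnected := by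
  obtain ⟨x, y, rfl | rfl | rfl | rfl⟩ := hs
  exacts [Set.ordConnected_Icc, Set.ordConnected_Ioo, Set.ordConnected_Ioc, Set.ordConnected_Ico]

/-- A finite interval graph is an intersection graph of nonempty compact intervals. -/
theorem IsIntervalGraph.exists_compact [Finite V] (h : IsIntervalGraph G) :
    ∃ l r : V → ℝ, (∀ v, l v ≤ r v) ∧ ∀ u v, G.Adj u v ↔ u ≠ v ∧ l u ≤ r v ∧ l v ≤ r u := by
  classical
  cases nonempty_fintype V
  obtain ⟨f, hf, hadj⟩ := h
  have conn := fun v => ordConnected_of_mem_intervals (hf v)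
  have hpt : ∀ p : V × V, ∃ t : ℝ, (f p.1 ∩ f p.2).Nonempty → t ∈ f p.1 ∩ f p.2 := by
    intro p
    by_cases hp : (f p.1 ∩ f p.2).Nonempty
    · exact ⟨hp.some, fun _ => hp.some_mem⟩
    · exact ⟨0, fun h => absurd h hp⟩
  choose pt hpt using hpt
  -- Finitely many points witness all intersections. Each nonempty `f v` shrinks to the hull of the
  -- witnesses it contains; since `f v` is convex, no new meetings arise.
  let T : V → Finset ℝ := fun v => (Finset.univ.image pt).filter (· ∈ f v)
  have hT : ∀ v t, t ∈ T v → t ∈ f v := fun v t ht => (Finset.mem_filter.1 ht).2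
  have hTpt : ∀ u v, (f u ∩ f v).Nonempty → pt (u, v) ∈ T u ∧ pt (u, v) ∈ T v := by
    intro u v huv
    have := hpt (u, v) huv
    exact ⟨Finset.mem_filter.2 ⟨Finset.mem_image_of_mem _ (Finset.mem_univ _), this.1⟩,
      Finset.mem_filter.2 ⟨Finset.mem_image_of_mem _ (Finset.mem_univ _), this.2⟩⟩
  have hTne : ∀ v, (f v).Nonempty → (T v).Nonempty := fun v hv =>
    ⟨_, (hTpt v v (by simpa using hv)).1⟩
  obtain ⟨B, hB⟩ := (Finset.univ.image pt).bddAbove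
  let ι : V → ℕ := fun v => (Fintype.equivFin V v : ℕ)
  have hι : Function.Injective ι := fun u v huv => by
    simpa [ι, Fin.val_inj] using huv
  -- An empty `f v`, such as `[1, 0]`, becomes a private point to the right of all witnesses.
  let far : V → ℝ := fun v => B + 1 + ι v
  have hfar : ∀ v, B < far v := fun v => by
    have : (0 : ℝ) ≤ ι v := Nat.cast_nonneg _
    simp only [far]; linarith
  let l : V → ℝ := fun v => if hv : (f v).Nonempty then (T v).min' (hTne v hv) else far v
  let r : V → ℝ := fun v => if hv : (f v).Nonempty then (T v).max' (hTne v hv) else far v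
  have hl : ∀ v, (f v).Nonempty → l v ∈ f v := fun v hv => by
    simp only [l, dif_pos hv]; exact hT _ _ (Finset.min'_mem _ _)
  have hr : ∀ v, (f v).Nonempty → r v ∈ f v := fun v hv => by
    simp only [r, dif_pos hv]; exact hT _ _ (Finset.max'_mem _ _)
  have hlT : ∀ v t, t ∈ T v → l v ≤ t := fun v t ht => by
    have hv : (f v).Nonempty := ⟨t, hT _ _ ht⟩
    simp only [l, dif_pos hv]; exact Finset.min'_le _ _ ht
  have hrT : ∀ v t, t ∈ T v → t ≤ r v := fun v t ht => by
    have hv : (f v).Nonempty := ⟨t, hT _ _ ht⟩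
    simp only [r, dif_pos hv]; exact Finset.le_max' _ _ ht
  have hrB : ∀ v, (f v).Nonempty → r v ≤ B := fun v hv => by
    simp only [r, dif_pos hv]
    exact hB (Finset.mem_filter.1 (Finset.max'_mem _ (hTne v hv))).1
  have hlr : ∀ v, l v ≤ r v := fun v => by
    by_cases hv : (f v).Nonempty
    · obtain ⟨t, ht⟩ := hTne v hv
      exact (hlT v t ht).trans (hrT v t ht)
    · simp only [l, r, dif_neg hv, le_refl]
  refine ⟨l, r, hlr, fun u v => ⟨fun huv => ⟨huv.ne, ?_⟩, ?_⟩⟩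
  · obtain ⟨h1, h2⟩ := hTpt u v ((hadj u v huv.ne).1 huv)
    exact ⟨(hlT _ _ h1).trans (hrT _ _ h2), (hlT _ _ h2).trans (hrT _ _ h1)⟩
  · rintro ⟨huv, h1, h2⟩
    rw [hadj u v huv]
    by_cases hu : (f u).Nonempty <;> by_cases hv : (f v).Nonempty
    · rcases le_total (l u) (l v) with h3 | h3
      · exact ⟨l v, (conn u).out (hl u hu) (hr u hu) ⟨h3, h2⟩, hl v hv⟩
      · exact ⟨l u, hl u hu, (conn v).out (hl v hv) (hr v hv) ⟨h3, h1⟩⟩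
    · have : l v = far v := dif_neg hv
      linarith [hrB u hu, hfar v]
    · have : l u = far u := dif_neg hu
      linarith [hrB v hv, hfar u]
    · have e1 : l u = far u := dif_neg hu
      have e2 : r u = far u := dif_neg hu
      have e3 : l v = far v := dif_neg hv
      have e4 : r v = far v := dif_neg hv
      have : (ι u : ℝ) = ι v := by
        have : far u = far v := by apply le_antisymm <;> linarith
        simpa [far] using this
      exact absurd (hι (by exact_mod_cast this)) huv

/-- An interval model with integer end points in which every integer between two end points is
both a left and a right end point. -/
structure Canonical (G : SimpleGraph V) (L R : V → ℤ) : Prop where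
  le : ∀ v, L v ≤ R v
  adj : ∀ u v, G.Adj u v ↔ u ≠ v ∧ L u ≤ R v ∧ L v ≤ R u
  left : ∀ {u v i}, L u ≤ i → i ≤ R v → ∃ w, L w = i
  right : ∀ {u v i}, L u ≤ i → i ≤ R v → ∃ w, R w = i

theorem Canonical.reverse {L R : V → ℤ} (h : Canonical G L R) :
    Canonical G (fun v => -R v) (fun v => -L v) where
  le v := neg_le_neg (h.le v)
  adj u v := by
    simp only [h.adj, neg_le_neg_iff]; tauto
  left {u v i} h1 h2 := by
    obtain ⟨w, hw⟩ := h.right (i := -i) (le_neg.1 h2) (neg_le.1 h1)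
    exact ⟨w, by omega⟩
  right {u v i} h1 h2 := by
    obtain ⟨w, hw⟩ := h.left (i := -i) (le_neg.1 h2) (neg_le.1 h1)
    exact ⟨w, by omega⟩

/-- The line is cut after each right end point that is followed by a left end point with no right
end point strictly in between; `C` collects these cuts, and `cnt` numbers the blocks. Some cut
separates `r u` from `l v` whenever `r u < l v`, so the meeting relation survives, and every block
contains both kinds of end point. -/
theorem IsIntervalGraph.exists_canonical [Finite V] (h : IsIntervalGraph G) :
    ∃ L R, Canonical G L R := by
  classical
  cases nonempty_fintype V
  obtain ⟨l, r, hlr, hadj⟩ := h.exists_compact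
  rcases isEmpty_or_nonempty V with hV | hV
  · exact ⟨fun _ => 0, fun _ => 0, fun _ => le_rfl, isEmptyElim, fun {u} => isEmptyElim u,
      fun {u} => isEmptyElim u⟩
  let C : Finset ℝ := (Finset.univ.image r).filter
    (fun c => ∃ x, c < l x ∧ ∀ w, c < r w → l x ≤ r w)
  let cnt : ℝ → ℕ := fun t => (C.filter (· < t)).card
  have memC : ∀ c, c ∈ C ↔ (∃ w, r w = c) ∧ ∃ x, c < l x ∧ ∀ w, c < r w → l x ≤ r w := by
    intro c; simp [C]
  have mono : ∀ s t, s ≤ t → cnt s ≤ cnt t := fun s t hst =>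
    Finset.card_le_card fun c hc => by
      rw [Finset.mem_filter] at hc ⊢
      exact ⟨hc.1, hc.2.trans_le hst⟩
  have strict : ∀ u v, r u < l v → cnt (r u) < cnt (l v) := by
    intro u v huv
    obtain ⟨w, hw, hmax⟩ := (Finset.univ.filter (fun w => r w < l v)).exists_max_image r
      ⟨u, by simpa using huv⟩
    simp only [Finset.mem_filter, Finset.mem_univ, true_and] at hw hmax
    have hC : r w ∈ C := (memC _).2 ⟨⟨w, rfl⟩, v, hw, fun w' hw' => by
      by_contra hc
      exact absurd (hmax w' (not_le.1 hc)) (not_le.2 hw')⟩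
    refine Finset.card_lt_card ((Finset.ssubset_iff_of_subset ?_).2 ⟨r w, ?_, ?_⟩)
    · intro c hc
      rw [Finset.mem_filter] at hc ⊢
      exact ⟨hc.1, hc.2.trans huv⟩
    · exact Finset.mem_filter.2 ⟨hC, hw⟩
    · simpa [hC] using hmax u huv
  have next : ∀ c ∈ C, ∃ x, cnt (l x) = cnt c + 1 := by
    intro c hc
    obtain ⟨-, x, hx, hx'⟩ := (memC c).1 hc
    refine ⟨x, ?_⟩
    have : C.filter (· < l x) = insert c (C.filter (· < c)) := by
      ext d
      simp only [Finset.mem_filter, Finset.mem_insert]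
      constructor
      · rintro ⟨hd, hdx⟩
        rcases lt_trichotomy d c with h1 | h1 | h1
        · exact .inr ⟨hd, h1⟩
        · exact .inl h1
        · obtain ⟨⟨w, rfl⟩, -⟩ := (memC d).1 hd
          exact absurd (hx' w h1) (not_le.2 hdx)
      · rintro (rfl | ⟨hd, h1⟩)
        · exact ⟨hc, hx⟩
        · exact ⟨hd, h1.trans hx⟩
    simp only [cnt, this]
    rw [Finset.card_insert_of_notMem (by simp)]
  have ceil : ∀ t, cnt t < C.card → ∃ c ∈ C, cnt c = cnt t := by
    intro t ht
    have : ∃ c ∈ C, t ≤ c := by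
      by_contra! hc
      exact ht.ne (congrArg Finset.card (Finset.filter_true_of_mem hc))
    obtain ⟨c, hc, hmin⟩ := (C.filter (t ≤ ·)).exists_min_image id (by
      obtain ⟨c, hc, hct⟩ := this
      exact ⟨c, Finset.mem_filter.2 ⟨hc, hct⟩⟩)
    rw [Finset.mem_filter] at hc
    refine ⟨c, hc.1, congrArg Finset.card (Finset.filter_congr fun d hd => ?_)⟩
    refine ⟨fun hdc => ?_, fun hdt => hdt.trans_le hc.2⟩
    by_contra hdt
    exact absurd (hmin d (Finset.mem_filter.2 ⟨hd, not_lt.1 hdt⟩)) (not_le.2 hdc)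
  have hleft : ∀ i ≤ C.card, ∃ x, cnt (l x) = i := by
    intro i
    induction i with
    | zero =>
      intro _
      obtain ⟨x, -, hx⟩ := Finset.univ.exists_min_image l Finset.univ_nonempty
      refine ⟨x, Finset.card_eq_zero.2 (Finset.filter_false_of_mem fun c hc => ?_)⟩
      obtain ⟨⟨w, rfl⟩, -⟩ := (memC c).1 hc
      exact not_lt.2 ((hx w (Finset.mem_univ _)).trans (hlr w))
    | succ i ih =>
      intro hi
      obtain ⟨x, hx⟩ := ih (by omega)
      obtain ⟨c, hc, hcx⟩ := ceil (l x) (by omega)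
      obtain ⟨y, hy⟩ := next c hc
      exact ⟨y, by omega⟩
  have hright : ∀ i ≤ C.card, ∃ x, cnt (r x) = i := by
    intro i hi
    obtain ⟨x, hx⟩ := hleft i hi
    -- A block before the last one closes with an element of `C`, itself a right end point. In the
    -- last block, an interval starting there must also end there.
    rcases hi.lt_or_eq with hi | rfl
    · obtain ⟨c, hc, hcx⟩ := ceil (l x) (by omega)
      obtain ⟨⟨w, rfl⟩, -⟩ := (memC c).1 hc
      exact ⟨w, by omega⟩
    · exact ⟨x, le_antisymm (Finset.card_le_card (Finset.filter_subset _ _))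
        (hx ▸ mono _ _ (hlr x))⟩
  have le_card : ∀ t, cnt t ≤ C.card := fun t => Finset.card_le_card (Finset.filter_subset _ _)
  have iff : ∀ u v, cnt (l u) ≤ cnt (r v) ↔ l u ≤ r v := fun u v =>
    ⟨fun h => not_lt.1 fun hc => absurd (strict _ _ hc) (not_lt.2 h), mono _ _⟩
  refine ⟨fun v => cnt (l v), fun v => cnt (r v), fun v => by exact_mod_cast mono _ _ (hlr v),
    fun u v => ?_, fun {u v i} h1 h2 => ?_, fun {u v i} h1 h2 => ?_⟩
  · rw [hadj, Nat.cast_le, Nat.cast_le, iff, iff]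
  · have := le_card (r v)
    obtain ⟨w, hw⟩ := hleft i.toNat (by omega)
    exact ⟨w, by omega⟩
  · have := le_card (r v)
    obtain ⟨w, hw⟩ := hright i.toNat (by omega)
    exact ⟨w, by omega⟩

/-! ### Strips in integer models and the induced subgraphs they yield. -/

/-- The integer intervals of `u` and `v` meet. -/
def Meet (L R : V → ℤ) (u v : V) : Prop := L u ≤ R v ∧ L v ≤ R u

theorem Meet.comm {L R : V → ℤ} {u v : V} : Meet L R u v ↔ Meet L R v u := and_comm

theorem Canonical.isIndContained_fromRel {L R : V → ℤ} (h : Canonical G L R) {W : Type*}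
    (r : W → W → Prop) (f : W → V)
    (hf : ∀ a b, a ≠ b → f a ≠ f b ∧ (Meet L R (f a) (f b) ↔ r a b ∨ r b a)) :
    SimpleGraph.fromRel r ⊴ G := by
  refine ⟨⟨⟨f, fun a b hab => ?_⟩, fun {a b} => ?_⟩⟩
  · by_contra hne
    exact (hf a b hne).1 hab
  · change G.Adj (f a) (f b) ↔ _
    rw [h.adj, SimpleGraph.fromRel_adj]
    constructor
    · rintro ⟨h1, h2⟩
      have hne : a ≠ b := fun hab => h1 (congrArg f hab)
      exact ⟨hne, (hf a b hne).2.1 h2⟩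
    · rintro ⟨hne, h2⟩
      exact ⟨(hf a b hne).1, (hf a b hne).2.2 h2⟩

/-- A strip of triangles in an interval model. The interval of `p (m + 1)` is `[e m, e (m + 1)]`. -/
structure Strip (L R : V → ℤ) (n : ℕ) (e : ℕ → ℤ) (p q : ℕ → V) : Prop where
  rp : ∀ m ≤ n + 1, R (p m) = e m
  lp : ∀ m ≤ n, L (p (m + 1)) = e m
  rq : ∀ m ≤ n, R (q m) < e (m + 1)
  lq : ∀ m < n, L (q (m + 1)) = e (m + 1)
  l0 : e 0 < L (q 0)

namespace Strip

variable {L R : V → ℤ} {n : ℕ} {e : ℕ → ℤ} {p q : ℕ → V}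

theorem le_lq (s : Strip L R n e p q) {m : ℕ} (hm : m ≤ n) : e m ≤ L (q m) := by
  rcases m with _ | m
  · exact s.l0.le
  · exact (s.lq m (by omega)).ge

theorem lt_succ (h : Canonical G L R) (s : Strip L R n e p q) {m : ℕ} (hm : m ≤ n) :
    e m < e (m + 1) :=
  ((s.le_lq hm).trans (h.le _)).trans_lt (s.rq m hm)

theorem mono (h : Canonical G L R) (s : Strip L R n e p q) {i j : ℕ} (hij : i ≤ j)
    (hj : j ≤ n + 1) : e i ≤ e j := by
  induction j, hij using Nat.le_induction with
  | base => exact le_rfl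
  | succ j hij ih => exact (ih (by omega)).trans (s.lt_succ h (by omega)).le

theorem strictMono (h : Canonical G L R) (s : Strip L R n e p q) {i j : ℕ} (hij : i < j)
    (hj : j ≤ n + 1) : e i < e j :=
  (s.lt_succ h (by omega)).trans_le (s.mono h hij hj)

theorem lp_le (h : Canonical G L R) (s : Strip L R n e p q) {m : ℕ} (hm : m ≤ n + 1) :
    L (p m) ≤ e m := s.rp m hm ▸ h.le _

theorem pp_aux (h : Canonical G L R) (s : Strip L R n e p q) {i j : ℕ} (hij : i < j)
    (hj : j ≤ n + 1) : p i ≠ p j ∧ (Meet L R (p i) (p j) ↔ j = i + 1) := by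
  obtain ⟨k, rfl⟩ : ∃ k, j = k + 1 := ⟨j - 1, by omega⟩
  have h1 := s.rp i (by omega)
  have h2 := s.rp (k + 1) hj
  have h3 := s.lp k (by omega)
  have h4 := s.strictMono h hij hj
  have h5 := s.lp_le h (m := i) (by omega)
  refine ⟨fun hp => by rw [hp] at h1; omega, fun hm => ?_, fun hk => ?_⟩
  · by_contra hk
    have := s.strictMono h (i := i) (j := k) (by omega) (by omega)
    have := hm.2
    omega
  · obtain rfl : k = i := by omega
    exact ⟨by omega, by omega⟩

theorem pp (h : Canonical G L R) (s : Strip L R n e p q) {i j : ℕ} (hi : i ≤ n + 1)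
    (hj : j ≤ n + 1) (hij : i ≠ j) :
    p i ≠ p j ∧ (Meet L R (p i) (p j) ↔ j = i + 1 ∨ i = j + 1) := by
  rcases hij.lt_or_gt with hij | hij
  · obtain ⟨h1, h2⟩ := s.pp_aux h hij hj
    exact ⟨h1, h2.trans (by omega)⟩
  · obtain ⟨h1, h2⟩ := s.pp_aux h hij hi
    exact ⟨h1.symm, Meet.comm.trans (h2.trans (by omega))⟩

theorem ne_of_not_meet (h : Canonical G L R) {u v : V} (huv : ¬ Meet L R u v) : u ≠ v := by
  rintro rfl
  exact huv ⟨h.le _, h.le _⟩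

theorem qq_aux (h : Canonical G L R) (s : Strip L R n e p q) {i j : ℕ} (hij : i < j)
    (hj : j ≤ n) : ¬ Meet L R (q i) (q j) := fun hm => by
  have h1 := s.rq i (by omega)
  have h2 := s.le_lq hj
  have h3 := s.mono h (i := i + 1) (j := j) hij (by omega)
  have := hm.2
  omega

theorem qq (h : Canonical G L R) (s : Strip L R n e p q) {i j : ℕ} (hi : i ≤ n)
    (hj : j ≤ n) (hij : i ≠ j) : q i ≠ q j ∧ ¬ Meet L R (q i) (q j) := by
  suffices H : ¬ Meet L R (q i) (q j) from ⟨ne_of_not_meet h H, H⟩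
  rcases hij.lt_or_gt with hij | hij
  · exact s.qq_aux h hij hj
  · rw [Meet.comm]
    exact s.qq_aux h hij hi

theorem qp (h : Canonical G L R) (s : Strip L R n e p q) {i j : ℕ} (hi : i ≤ n)
    (hj : j ≤ n + 1) :
    q i ≠ p j ∧ (Meet L R (q i) (p j) ↔ (j = i ∧ 1 ≤ i) ∨ j = i + 1) := by
  have h1 := s.rp j hj
  have h2 := s.le_lq hi
  have h3 := s.rq i hi
  have h4 := h.le (q i)
  have h5 := h.le (p j)
  rcases lt_trichotomy j (i + 1) with h6 | rfl | h6
  · rcases (Nat.lt_succ_iff.1 h6).lt_or_eq with h7 | rfl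
    · have := s.strictMono h h7 (by omega)
      have H : ¬ Meet L R (q i) (p j) := fun hm => by have := hm.1; omega
      exact ⟨ne_of_not_meet h H, iff_of_false H (by omega)⟩
    · rcases j with _ | j
      · have := s.l0
        have H : ¬ Meet L R (q 0) (p 0) := fun hm => by have := hm.1; omega
        exact ⟨ne_of_not_meet h H, iff_of_false H (by omega)⟩
      · have h7 := s.lq j (by omega)
        have h8 := s.lp j (by omega)
        have := s.lt_succ h (m := j) (by omega)
        refine ⟨fun hp => by rw [hp] at h7; omega, iff_of_true ⟨by omega, by omega⟩ (by omega)⟩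
  · have h7 := s.lp i hi
    refine ⟨fun hp => by rw [hp] at h3; omega, iff_of_true ⟨by omega, by omega⟩ (by omega)⟩
  · obtain ⟨k, rfl⟩ : ∃ k, j = k + 1 := ⟨j - 1, by omega⟩
    have h7 := s.lp k (by omega)
    have := s.mono h (i := i + 1) (j := k) (by omega) (by omega)
    have H : ¬ Meet L R (q i) (p (k + 1)) := fun hm => by have := hm.2; omega
    exact ⟨ne_of_not_meet h H, iff_of_false H (by omega)⟩

/-- A vertex that starts after `q n` ends, and no later than `p (n + 1)` ends, continues the strip:
`p (n + 1)` is its only neighbour there, by this lemma and `cap_q`. -/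
theorem cap_p (h : Canonical G L R) (s : Strip L R n e p q) {v : V} (hv : R (q n) < L v)
    (hv' : L v ≤ e (n + 1)) {m : ℕ} (hm : m ≤ n + 1) :
    v ≠ p m ∧ (Meet L R v (p m) ↔ m = n + 1) := by
  have h1 := s.le_lq (m := n) le_rfl
  have h2 := h.le (q n)
  have h3 := s.rp m hm
  have h4 := h.le v
  rcases hm.lt_or_eq with h5 | rfl
  · have := s.mono h (i := m) (j := n) (by omega) (by omega)
    have H : ¬ Meet L R v (p m) := fun hm => by have := hm.1; omega
    exact ⟨ne_of_not_meet h H, iff_of_false H (by omega)⟩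
  · have h5 := s.lp n le_rfl
    refine ⟨fun hp => by rw [hp] at hv; omega, iff_of_true ⟨by omega, by omega⟩ (by omega)⟩

theorem cap_q (h : Canonical G L R) (s : Strip L R n e p q) {v : V} (hv : R (q n) < L v)
    {m : ℕ} (hm : m ≤ n) : v ≠ q m ∧ ¬ Meet L R v (q m) := by
  suffices H : ¬ Meet L R v (q m) from ⟨ne_of_not_meet h H, H⟩
  intro hvq
  have h1 := hvq.1
  rcases hm.lt_or_eq with h5 | rfl
  · have := s.rq m hm
    have := s.mono h (i := m + 1) (j := n) (by omega) (by omega)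
    have := s.le_lq (m := n) le_rfl
    have := h.le (q n)
    omega
  · omega

/-- Two disjoint vertices that extend a strip at the same place yield `R n`. -/
theorem isIndContained_graphR (h : Canonical G L R) (s : Strip L R n e p q) {v w : V} (hv : R (q n) < L v)
    (hv' : L v ≤ e (n + 1)) (hw : R (q n) < L w) (hw' : L w ≤ e (n + 1))
    (hvw : ¬ Meet L R v w) : graphR n ⊴ G := by
  let f : Fin (n + 3) ⊕ Fin (n + 2) → V := fun a =>
    match a with
    | .inl m => if m.val ≤ n + 1 then p m else v
    | .inr m => if m.val ≤ n then q m else w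
  have key : ∀ (a : Fin (n + 3)) (b : Fin (n + 2)), f (.inr b) ≠ f (.inl a) ∧
      (Meet L R (f (.inr b)) (f (.inl a)) ↔
        (a.val = b.val ∧ 1 ≤ b.val) ∨ (a.val = b.val + 1 ∧ b.val ≤ n)) := by
    intro a b
    have ha := a.isLt
    have hb := b.isLt
    simp only [f]
    split_ifs with h1 h2 h2
    · obtain ⟨h3, h4⟩ := s.qp h h1 h2
      exact ⟨h3, h4.trans (by omega)⟩
    · obtain ⟨h3, h4⟩ := s.cap_q h hv h1
      exact ⟨h3.symm, iff_of_false (fun h => h4 h.symm) (by omega)⟩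
    · obtain ⟨h3, h4⟩ := s.cap_p h hw hw' h2
      exact ⟨h3, h4.trans (by omega)⟩
    · have hwv : ¬ Meet L R w v := fun h => hvw h.symm
      exact ⟨ne_of_not_meet h hwv, iff_of_false hwv (by omega)⟩
  refine h.isIndContained_fromRel _ f ?_
  rintro (a | a) (b | b) hab
  · have ha := a.isLt
    have hb := b.isLt
    have hne : a.val ≠ b.val := fun h => hab (congrArg _ (Fin.ext h))
    simp only [f]
    split_ifs with h1 h2 h2
    · exact s.pp h h1 h2 hne
    · obtain ⟨h3, h4⟩ := s.cap_p h hv hv' h1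
      exact ⟨h3.symm, Meet.comm.trans (h4.trans (by omega))⟩
    · obtain ⟨h3, h4⟩ := s.cap_p h hv hv' h2
      exact ⟨h3, h4.trans (by omega)⟩
    · omega
  · obtain ⟨h1, h2⟩ := key a b
    refine ⟨h1.symm, Meet.comm.trans (h2.trans ?_)⟩
    simp
  · obtain ⟨h1, h2⟩ := key b a
    refine ⟨h1, h2.trans ?_⟩
    simp
  · have ha := a.isLt
    have hb := b.isLt
    have hne : a.val ≠ b.val := fun h => hab (congrArg _ (Fin.ext h))
    simp only [f, or_self, iff_false]
    split_ifs with h1 h2 h2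
    · exact s.qq h h1 h2 hne
    · obtain ⟨h3, h4⟩ := s.cap_q h hw h1
      exact ⟨h3.symm, fun h => h4 h.symm⟩
    · exact s.cap_q h hw h2
    · omega

/-- Two strips from opposite sides that meet crosswise yield `T n j`. -/
theorem isIndContained_graphT (h : Canonical G L R) (s : Strip L R n e p q) {j : ℕ} {e' : ℕ → ℤ}
    {p' q' : ℕ → V} (s' : Strip (fun v => -R v) (fun v => -L v) j e' p' q')
    (h1 : R (q n) < L (q' j)) (h2 : L (p' (j + 1)) ≤ R (q n)) (h3 : L (q' j) ≤ R (p (n + 1)))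
    (h4 : e n < L (p' (j + 1))) (h4' : R (p (n + 1)) < -e' j) :
    graphT n j ⊴ G := by
  have hm : ∀ u v, Meet (fun v => -R v) (fun v => -L v) u v ↔ Meet L R u v := by
    intro u v
    simp only [Meet, neg_le_neg_iff]
    tauto
  have pR : ∀ m ≤ n, R (p m) < L (p' (j + 1)) := fun m hm' => by
    rw [s.rp m (by omega)]
    exact (s.mono h hm' (by omega)).trans_lt h4
  have qR : ∀ m < n, R (q m) < L (p' (j + 1)) := fun m hm' =>
    (s.rq m (by omega)).trans_le ((s.mono h (i := m + 1) (j := n) hm' (by omega)).trans h4.le)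
  have pL : ∀ m ≤ j, R (p (n + 1)) < L (p' m) := fun m hm' => by
    have e1 := s'.rp m (by omega)
    have e2 := s'.mono h.reverse hm' (by omega)
    omega
  have qL : ∀ m < j, R (p (n + 1)) < L (q' m) := fun m hm' => by
    have e1 := s'.rq m (by omega)
    have e2 := s'.mono h.reverse (i := m + 1) (j := j) hm' (by omega)
    omega
  have e1 := s.rq n le_rfl
  have e2 := s.rp (n + 1) le_rfl
  have e3 := s'.rq j le_rfl
  have e4 := s'.rp (j + 1) le_rfl
  have e5 := h.le (p (n + 1))
  have e6 := h.le (p' (j + 1))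
  have e7 := h.le (q n)
  have e8 := h.le (q' j)
  have e9 := s.lp n le_rfl
  have e10 := s'.lp j le_rfl
  have e11 := s.le_lq (m := n) le_rfl
  have e12 := s'.le_lq (m := j) le_rfl
  have cross : ∀ {u v}, R u < L v → u ≠ v ∧ ¬ Meet L R u v := fun {u v} huv => by
    have H : ¬ Meet L R u v := fun hm => by have := hm.2; omega
    exact ⟨ne_of_not_meet h H, H⟩
  have qR' : ∀ m ≤ n, R (q m) ≤ R (q n) := fun m hm' => by
    rcases hm'.lt_or_eq with hm' | rfl
    · exact ((qR m hm').trans_le h2).le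
    · exact le_rfl
  have qL' : ∀ m ≤ j, L (q' j) ≤ L (q' m) := fun m hm' => by
    rcases hm'.lt_or_eq with hm' | rfl
    · exact h3.trans (qL m hm').le
    · exact le_rfl
  have pR' : ∀ m ≤ n, R (p m) < R (p (n + 1)) := fun m hm' => by
    have := pR m hm'
    omega
  let f : (Fin (n + 2) ⊕ Fin (n + 1)) ⊕ (Fin (j + 2) ⊕ Fin (j + 1)) → V := fun a =>
    match a with
    | .inl (.inl m) => p m
    | .inl (.inr m) => q m
    | .inr (.inl m) => p' m
    | .inr (.inr m) => q' m
  have key : ∀ a b, f (.inl a) ≠ f (.inr b) ∧ (Meet L R (f (.inl a)) (f (.inr b)) ↔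
      match a, b with
      | .inl a, .inl b => a.val = n + 1 ∧ b.val = j + 1
      | .inl a, .inr b => a.val = n + 1 ∧ b.val = j
      | .inr a, .inl b => a.val = n ∧ b.val = j + 1
      | .inr _, .inr _ => False) := by
    rintro (⟨a, ha⟩ | ⟨a, ha⟩) (⟨b, hb⟩ | ⟨b, hb⟩)
    all_goals simp only [f]
    · by_cases ha' : a = n + 1
      · subst ha'
        by_cases hb' : b = j + 1
        · subst hb'
          exact ⟨fun hp => by rw [hp] at e9; omega, iff_of_true ⟨by omega, by omega⟩ (by simp)⟩
        · obtain ⟨c1, c2⟩ := cross (pL b (by omega))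
          exact ⟨c1, iff_of_false c2 (by omega)⟩
      · have := pR a (by omega)
        have := pR' a (by omega)
        have H : R (p a) < L (p' b) := by
          by_cases hb' : b = j + 1
          · rwa [hb']
          · have := pL b (by omega)
            omega
        obtain ⟨c1, c2⟩ := cross H
        exact ⟨c1, iff_of_false c2 (by omega)⟩
    · have := qL' b (by omega)
      by_cases ha' : a = n + 1
      · subst ha'
        by_cases hb' : b = j
        · subst hb'
          exact ⟨fun hp => by rw [hp] at e9; omega, iff_of_true ⟨by omega, by omega⟩ (by simp)⟩
        · obtain ⟨c1, c2⟩ := cross (qL b (by omega))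
          exact ⟨c1, iff_of_false c2 (by omega)⟩
      · have := pR a (by omega)
        obtain ⟨c1, c2⟩ := cross (u := p a) (v := q' b) (by omega)
        exact ⟨c1, iff_of_false c2 (by omega)⟩
    · have := qR' a (by omega)
      by_cases hb' : b = j + 1
      · subst hb'
        by_cases ha' : a = n
        · subst ha'
          exact ⟨fun hp => by rw [← hp] at e10; omega,
            iff_of_true ⟨by omega, by omega⟩ (by simp)⟩
        · obtain ⟨c1, c2⟩ := cross (qR a (by omega))
          exact ⟨c1, iff_of_false c2 (by omega)⟩
      · have := pL b (by omega)
        obtain ⟨c1, c2⟩ := cross (u := q a) (v := p' b) (by omega)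
        exact ⟨c1, iff_of_false c2 (by omega)⟩
    · have := qR' a (by omega)
      have := qL' b (by omega)
      obtain ⟨c1, c2⟩ := cross (u := q a) (v := q' b) (by omega)
      exact ⟨c1, iff_of_false c2 id⟩
  refine h.isIndContained_fromRel _ f ?_
  rintro (a | a) (b | b) hab
  · rcases a with a | a <;> rcases b with b | b
    · have hne : a.val ≠ b.val := fun h => hab (by rw [Fin.ext h])
      exact s.pp h (by omega) (by omega) hne
    · obtain ⟨c1, c2⟩ := s.qp h (i := b) (j := a) (by omega) (by omega)
      exact ⟨c1.symm, Meet.comm.trans (c2.trans (by simp [stripT]))⟩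
    · obtain ⟨c1, c2⟩ := s.qp h (i := a) (j := b) (by omega) (by omega)
      exact ⟨c1, c2.trans (by simp [stripT])⟩
    · have hne : a.val ≠ b.val := fun h => hab (by rw [Fin.ext h])
      obtain ⟨c1, c2⟩ := s.qq h (i := a) (j := b) (by omega) (by omega) hne
      exact ⟨c1, iff_of_false c2 (by simp [stripT])⟩
  · obtain ⟨c1, c2⟩ := key a b
    refine ⟨c1, c2.trans ?_⟩
    rcases a with a | a <;> rcases b with b | b <;> simp
  · obtain ⟨c1, c2⟩ := key b a
    refine ⟨c1.symm, Meet.comm.trans (c2.trans ?_)⟩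
    rcases a with a | a <;> rcases b with b | b <;> simp
  · rcases a with a | a <;> rcases b with b | b
    · have hne : a.val ≠ b.val := fun h => hab (by rw [Fin.ext h])
      obtain ⟨c1, c2⟩ := s'.pp h.reverse (i := a) (j := b) (by omega) (by omega) hne
      exact ⟨c1, (hm _ _).symm.trans c2⟩
    · obtain ⟨c1, c2⟩ := s'.qp h.reverse (i := b) (j := a) (by omega) (by omega)
      exact ⟨c1.symm, Meet.comm.trans ((hm _ _).symm.trans (c2.trans (by simp [stripT])))⟩
    · obtain ⟨c1, c2⟩ := s'.qp h.reverse (i := a) (j := b) (by omega) (by omega)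
      exact ⟨c1, (hm _ _).symm.trans (c2.trans (by simp [stripT]))⟩
    · have hne : a.val ≠ b.val := fun h => hab (by rw [Fin.ext h])
      obtain ⟨c1, c2⟩ := s'.qq h.reverse (i := a) (j := b) (by omega) (by omega) hne
      exact ⟨c1, iff_of_false (fun h => c2 ((hm _ _).2 h)) (by simp [stripT])⟩

/-- The graph `S (n + 1)` or `S'' (n + 1)` as the graph of a relation. -/
theorem isIndContained_apex (h : Canonical G L R) (s : Strip L R n e p q) {v w z : V} (hv : L v = R (q n) + 1)
    (hw : L w = e (n + 1)) (hw' : e (n + 1) ≤ R v) (hz : L z ≤ R (q n)) (hz' : R z = R (q n) + 1)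
    (hvw : L v < L w) (hzn : e n ≤ L z) {r : _ → _ → Prop}
    (hr : ∀ a b, r (some a) (some b) ↔ stripS (n + 1) a b) (hr' : ∀ a, ¬ r a none)
    (hri : ∀ m, r none (some (.inr m)) ↔ m.val = 0 ∨ m.val = 1)
    (hrl : ∀ m, r none (some (.inl m)) ↔ m.val = 1 ∨ (m.val = 2 ∧ L z = e n)) :
    SimpleGraph.fromRel r ⊴ G := by
  -- The strip is numbered backwards, with `w`, `v`, `z` as bottom vertex `0`, top vertex `0` and
  -- apex. The apex meets bottom vertex `2`, which is `p n`, exactly when `L z = e n`; this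
  -- separates `graphS''` from `graphS`.
  let f : Option (Fin (n + 1 + 2) ⊕ Fin (n + 1 + 1)) → V := fun a =>
    match a with
    | none => z
    | some (.inl m) => if m.val = 0 then w else p (n + 2 - m)
    | some (.inr m) => if m.val = 0 then v else q (n + 1 - m)
  have e1 := s.rp (n + 1) le_rfl
  have e2 := s.lp n le_rfl
  have e3 := s.le_lq (m := n) le_rfl
  have e4 := h.le (q n)
  have e5 := h.le w
  have nm : ∀ {a b}, R a < L b → a ≠ b ∧ ¬ Meet L R a b := fun {u v} huv => by
    have H : ¬ Meet L R u v := fun hm => by have := hm.2; omega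
    exact ⟨ne_of_not_meet h H, H⟩
  have key : ∀ (a : Fin (n + 1 + 2)) (b : Fin (n + 1 + 1)),
      f (some (.inr b)) ≠ f (some (.inl a)) ∧
      (Meet L R (f (some (.inr b))) (f (some (.inl a))) ↔ stripS (n + 1) (.inr b) (.inl a)) := by
    rintro ⟨a, ha⟩ ⟨b, hb⟩
    simp only [f, stripS]
    split_ifs with h1 h2 h2
    · subst h1 h2
      exact ⟨fun hp => by rw [hp] at hvw; omega, iff_of_true ⟨by omega, by omega⟩ (by simp)⟩
    · obtain ⟨c1, c2⟩ := s.cap_p h (v := v) (m := n + 2 - a) (by omega) (by omega) (by omega)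
      exact ⟨c1, c2.trans (by omega)⟩
    · obtain ⟨c1, c2⟩ := s.cap_q h (v := w) (m := n + 1 - b) (by omega) (by omega)
      exact ⟨c1.symm, iff_of_false (fun h => c2 h.symm) (by omega)⟩
    · obtain ⟨c1, c2⟩ := s.qp h (i := n + 1 - b) (j := n + 2 - a) (by omega) (by omega)
      exact ⟨c1, c2.trans (by omega)⟩
  have keyp : ∀ a, z ≠ f (some (.inl a)) ∧
      (Meet L R z (f (some (.inl a))) ↔ a.val = 1 ∨ (a.val = 2 ∧ L z = e n)) := by
    rintro ⟨a, ha⟩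
    simp only [f]
    split_ifs with h1
    · obtain ⟨c1, c2⟩ := nm (a := z) (b := w) (by omega)
      exact ⟨c1, iff_of_false c2 (by omega)⟩
    · have e6 := s.rp (n + 2 - a) (by omega)
      have e7 := s.lp_le h (m := n + 2 - a) (by omega)
      rcases (show a = 1 ∨ a = 2 ∨ 3 ≤ a by omega) with rfl | rfl | h2
      · rw [show n + 2 - 1 = n + 1 by omega] at *
        exact ⟨fun hp => by rw [hp] at hz'; omega, iff_of_true ⟨by omega, by omega⟩ (by simp)⟩
      · rw [show n + 2 - 2 = n by omega] at *
        refine ⟨fun hp => by rw [hp] at hz'; omega, ?_⟩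
        exact ⟨fun hm => .inr ⟨rfl, by have := hm.1; omega⟩,
          fun hm => ⟨by rcases hm with hm | hm <;> omega, by omega⟩⟩
      · have := s.strictMono h (i := n + 2 - a) (j := n) (by omega) (by omega)
        obtain ⟨c1, c2⟩ := nm (a := p (n + 2 - a)) (b := z) (by omega)
        exact ⟨c1.symm, iff_of_false (fun h => c2 h.symm) (by omega)⟩
  have keyq : ∀ a, z ≠ f (some (.inr a)) ∧
      (Meet L R z (f (some (.inr a))) ↔ a.val = 0 ∨ a.val = 1) := by
    rintro ⟨a, ha⟩
    simp only [f]
    split_ifs with h1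
    · exact ⟨fun hp => by rw [hp] at hz; omega, iff_of_true ⟨by omega, by omega⟩ (by omega)⟩
    · rcases (show a = 1 ∨ 2 ≤ a by omega) with rfl | h2
      · rw [show n + 1 - 1 = n by omega]
        exact ⟨fun hp => by rw [hp] at hz'; omega, iff_of_true ⟨by omega, by omega⟩ (by simp)⟩
      · have := s.rq (n + 1 - a) (by omega)
        have := s.mono h (i := n + 1 - a + 1) (j := n) (by omega) (by omega)
        obtain ⟨c1, c2⟩ := nm (a := q (n + 1 - a)) (b := z) (by omega)
        exact ⟨c1.symm, iff_of_false (fun h => c2 h.symm) (by omega)⟩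
  refine h.isIndContained_fromRel _ f ?_
  rintro (_ | a | a) (_ | b | b) hab
  · exact absurd rfl hab
  · exact ⟨(keyp b).1, (keyp b).2.trans (by simp [hrl, hr'])⟩
  · exact ⟨(keyq b).1, (keyq b).2.trans (by simp [hri, hr'])⟩
  · exact ⟨(keyp a).1.symm, Meet.comm.trans ((keyp a).2.trans (by simp [hrl, hr']))⟩
  · have hne : a.val ≠ b.val := fun h => hab (by rw [Fin.ext h])
    have ha := a.isLt
    have hb := b.isLt
    simp only [hr, f, stripS]
    split_ifs with h1 h2 h2
    · omega
    · obtain ⟨c1, c2⟩ := s.cap_p h (v := w) (m := n + 2 - b) (by omega) (by omega) (by omega)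
      exact ⟨c1, c2.trans (by omega)⟩
    · obtain ⟨c1, c2⟩ := s.cap_p h (v := w) (m := n + 2 - a) (by omega) (by omega) (by omega)
      exact ⟨c1.symm, Meet.comm.trans (c2.trans (by omega))⟩
    · obtain ⟨c1, c2⟩ := s.pp h (i := n + 2 - a) (j := n + 2 - b) (by omega) (by omega) (by omega)
      exact ⟨c1, c2.trans (by omega)⟩
  · obtain ⟨c1, c2⟩ := key a b
    exact ⟨c1.symm, Meet.comm.trans (c2.trans (by simp [hr, stripS]))⟩
  · exact ⟨(keyq a).1.symm, Meet.comm.trans ((keyq a).2.trans (by simp [hri, hr']))⟩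
  · obtain ⟨c1, c2⟩ := key b a
    exact ⟨c1, c2.trans (by simp [hr, stripS])⟩
  · have hne : a.val ≠ b.val := fun h => hab (by rw [Fin.ext h])
    have ha := a.isLt
    have hb := b.isLt
    simp only [hr, f, stripS, or_self, iff_false]
    split_ifs with h1 h2 h2
    · omega
    · exact s.cap_q h (by omega) (by omega)
    · obtain ⟨c1, c2⟩ := s.cap_q h (v := v) (m := n + 1 - a) (by omega) (by omega)
      exact ⟨c1.symm, fun h => c2 h.symm⟩
    · exact s.qq h (by omega) (by omega) (by omega)

/-- This is the apex configuration for `n = 0` with `z` reaching back to `p 0`: `graphG₁` plays the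
part of the absent `S'' 1`. -/
theorem isIndContained_graphG₁ (h : Canonical G L R) (s : Strip L R 0 e p q) {v w z : V} (hv : L v = R (q 0) + 1)
    (hw : L w = e 1) (hw' : e 1 ≤ R v) (hz : L z ≤ e 0) (hz' : R z = R (q 0) + 1)
    (hvw : L v < L w) : graphG₁ ⊴ G := by
  have e1 := s.rp 1 le_rfl
  have e2 := s.lp 0 le_rfl
  have e3 := s.l0
  have e4 := h.le (q 0)
  have e5 := h.le w
  have e6 := s.rp 0 (by omega)
  have e7 := h.le (p 0)
  have e8 := s.rq 0 le_rfl
  simp only [zero_add] at e2 e8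
  let f : Fin 6 → V := ![p 1, z, v, p 0, q 0, w]
  have key : ∀ a b, a < b → f a ≠ f b ∧ (Meet L R (f a) (f b) ↔ graphG₁.Adj a b) := by
    have yes : ∀ a b, L (f a) ≠ L (f b) ∨ R (f a) ≠ R (f b) → Meet L R (f a) (f b) →
        graphG₁.Adj a b → f a ≠ f b ∧ (Meet L R (f a) (f b) ↔ graphG₁.Adj a b) :=
      fun a b h1 h2 h3 => ⟨fun hab => by rw [hab] at h1; simp at h1, iff_of_true h2 h3⟩
    have no : ∀ a b, R (f a) < L (f b) ∨ R (f b) < L (f a) → ¬ graphG₁.Adj a b →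
        f a ≠ f b ∧ (Meet L R (f a) (f b) ↔ graphG₁.Adj a b) := fun a b h1 h3 => by
      have H : ¬ Meet L R (f a) (f b) := fun hm => by
        have := hm.1; have := hm.2; omega
      exact ⟨ne_of_not_meet h H, iff_of_false H h3⟩
    intro a b hab
    fin_cases a <;> fin_cases b <;>
    first
    | exact absurd hab (by decide)
    | exact yes _ _ (by simp [f]; omega) (by simp [f, Meet]; omega)
        (by rw [graphG₁_adj]; decide)
    | exact no _ _ (by simp [f]; omega) (by rw [graphG₁_adj]; decide)
  refine ⟨⟨⟨f, fun a b hab => ?_⟩, fun {a b} => ?_⟩⟩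
  · rcases lt_trichotomy a b with h1 | h1 | h1
    · exact absurd hab (key _ _ h1).1
    · exact h1
    · exact absurd hab.symm (key _ _ h1).1
  · change G.Adj (f a) (f b) ↔ _
    rw [h.adj]
    rcases lt_trichotomy a b with h1 | rfl | h1
    · exact (and_iff_right (key _ _ h1).1).trans (key _ _ h1).2
    · simp
    · rw [graphG₁.adj_comm]
      exact (and_iff_right (key _ _ h1).1.symm).trans (Meet.comm.trans (key _ _ h1).2)

end Strip

/-! ### Tightness of strips in graphs without forbidden subgraphs. -/

/-- The graph contains none of the forbidden induced subgraphs. -/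
def IsFreeOfForbidden (G : SimpleGraph V) : Prop :=
  IsFreeOf G ({⟨Fin 6, graphG₁⟩} ∪ familyR ∪ familyS ∪ familyS'' ∪ familyT)

namespace IsFreeOfForbidden

theorem not_graphG₁ (h : IsFreeOfForbidden G) : ¬ graphG₁ ⊴ G := h ⟨_, graphG₁⟩ (.inl (.inl (.inl (.inl rfl))))

theorem not_graphR (h : IsFreeOfForbidden G) (i : ℕ) : ¬ graphR i ⊴ G := h ⟨_, graphR i⟩ (.inl (.inl (.inl (.inr ⟨i, rfl⟩))))

theorem not_graphS (h : IsFreeOfForbidden G) {i : ℕ} (hi : 1 ≤ i) : ¬ graphS i ⊴ G :=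
  h ⟨_, graphS i⟩ (.inl (.inl (.inr ⟨i, hi, rfl⟩)))

theorem not_graphS'' (h : IsFreeOfForbidden G) {i : ℕ} (hi : 2 ≤ i) : ¬ graphS'' i ⊴ G :=
  h ⟨_, graphS'' i⟩ (.inl (.inr ⟨i, hi, rfl⟩))

theorem not_graphT (h : IsFreeOfForbidden G) {i j : ℕ} (hij : j ≤ i) : ¬ graphT i j ⊴ G :=
  h ⟨_, graphT i j⟩ (.inr ⟨i, j, hij, rfl⟩)

end IsFreeOfForbidden

namespace Strip

variable {L R : V → ℤ} {n : ℕ} {e : ℕ → ℤ} {p q : ℕ → V}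

theorem truncate (s : Strip L R (n + 1) e p q) : Strip L R n e p q where
  rp m hm := s.rp m (by omega)
  lp m hm := s.lp m (by omega)
  rq m hm := s.rq m (by omega)
  lq m hm := s.lq m (by omega)
  l0 := s.l0

/-- Once strips are known to be tight, applying tightness before and after the exchange forces `z`
to end where `p (n + 1)` does. -/
theorem replace (s : Strip L R n e p q) {z : V} (hz : L z = e n) (hz' : R (q n) < R z) :
    Strip L R n (Function.update e (n + 1) (R z)) (Function.update p (n + 1) z) q where
  rp m hm := by
    rcases hm.lt_or_eq with hm' | rfl
    · simp only [Function.update_of_ne hm'.ne, s.rp m hm]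
    · simp
  lp m hm := by
    rw [Function.update_of_ne (show m ≠ n + 1 by omega)]
    rcases hm.lt_or_eq with hm' | rfl
    · rw [Function.update_of_ne (show m + 1 ≠ n + 1 by omega), s.lp m hm]
    · simpa using hz
  rq m hm := by
    rcases hm.lt_or_eq with hm' | rfl
    · rw [Function.update_of_ne (show m + 1 ≠ n + 1 by omega)]
      exact s.rq m hm
    · simpa using hz'
  lq m hm := by
    rw [Function.update_of_ne (show m + 1 ≠ n + 1 by omega)]
    exact s.lq m hm
  l0 := by
    rw [Function.update_of_ne (show 0 ≠ n + 1 by omega)]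
    exact s.l0

theorem extend (s : Strip L R n e p q) {u t : V} (hu : L u = e (n + 1)) (ht : L t = e (n + 1))
    (htu : R t < R u) :
    Strip L R (n + 1) (Function.update e (n + 2) (R u)) (Function.update p (n + 2) u)
      (Function.update q (n + 1) t) where
  rp m hm := by
    rcases hm.lt_or_eq with hm' | rfl
    · simp only [Function.update_of_ne (show m ≠ n + 2 by omega), s.rp m (by omega)]
    · simp
  lp m hm := by
    rw [Function.update_of_ne (show m ≠ n + 2 by omega)]
    rcases hm.lt_or_eq with hm' | rfl
    · rw [Function.update_of_ne (show m + 1 ≠ n + 2 by omega), s.lp m (by omega)]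
    · simpa using hu
  rq m hm := by
    rcases hm.lt_or_eq with hm' | rfl
    · rw [Function.update_of_ne (show m + 1 ≠ n + 2 by omega),
        Function.update_of_ne (show m ≠ n + 1 by omega)]
      exact s.rq m (by omega)
    · simpa using htu
  lq m hm := by
    rw [Function.update_of_ne (show m + 1 ≠ n + 2 by omega)]
    rcases (Nat.lt_succ_iff.1 hm).lt_or_eq with hm' | rfl
    · rw [Function.update_of_ne (show m + 1 ≠ n + 1 by omega)]
      exact s.lq m hm'
    · simpa using ht
  l0 := by
    rw [Function.update_of_ne (show 0 ≠ n + 2 by omega),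
      Function.update_of_ne (show 0 ≠ n + 1 by omega)]
    exact s.l0

/-- The strip formed by a claw with centre `c` and leaves `l`, `m`. -/
theorem of_claw {l c m : V} (hl : R l = L c) (hm : L c < L m) (hm' : R m < R c) :
    Strip L R 0 (fun k => if k = 0 then L c else R c) (fun k => if k = 0 then l else c)
      (fun _ => m) where
  rp k hk := by by_cases h : k = 0 <;> simp [h, hl]
  lp k hk := by obtain rfl : k = 0 := by omega
                simp
  rq k hk := by simpa using hm'
  lq k hk := by omega
  l0 := by simpa using hm

/-- The configuration is symmetric under reflection, so the longer strip can be taken as the first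
half of `graphT`. -/
theorem false_of_cross (h : Canonical G L R) (hG : IsFreeOfForbidden G) (s : Strip L R n e p q)
    {j : ℕ} {e' : ℕ → ℤ} {p' q' : ℕ → V}
    (s' : Strip (fun v => -R v) (fun v => -L v) j e' p' q')
    (h1 : R (q n) < L (q' j)) (h2 : L (p' (j + 1)) ≤ R (q n)) (h3 : L (q' j) ≤ R (p (n + 1)))
    (h4 : e n < L (p' (j + 1))) (h4' : R (p (n + 1)) < -e' j) : False := by
  rcases le_total j n with hjn | hjn
  · exact hG.not_graphT hjn (s.isIndContained_graphT h s' h1 h2 h3 h4 h4')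
  · have s2 : Strip (fun v => -(fun v => -L v) v) (fun v => -(fun v => -R v) v) n e p q := by
      simpa only [neg_neg] using s
    refine hG.not_graphT hjn (s'.isIndContained_graphT h.reverse s2 ?_ ?_ ?_ ?_ ?_) <;> omega

/-- In a gap, the canonical model supplies `v` starting at `R (q n) + 1`, `z` ending there, and `w`
starting at `e (n + 1)`. If `w` is disjoint from `v`, or `z` starts after `q n` ends, two disjoint
vertices continue the strip and `graphR` appears. Otherwise `z` is an apex, giving `graphS`,
`graphS''` or `graphG₁` according to `L z` and `n`. Only `L z < e n` with `n ≠ 0` escapes. -/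
theorem gap_or (h : Canonical G L R) (hG : IsFreeOfForbidden G) (s : Strip L R n e p q) :
    R (q n) + 1 = e (n + 1) ∨
      n ≠ 0 ∧ ∃ z v, L z < e n ∧ R z = R (q n) + 1 ∧ L v = R (q n) + 1 := by
  by_contra! hcon
  obtain ⟨hgap, hcon⟩ := hcon
  have h1 := s.rq n le_rfl
  have h2 := s.rp (n + 1) le_rfl
  have h3 := h.le (q n)
  obtain ⟨v, hv⟩ := h.left (u := q n) (v := p (n + 1)) (i := R (q n) + 1) (by omega) (by omega)
  obtain ⟨z, hz⟩ := h.right (u := q n) (v := p (n + 1)) (i := R (q n) + 1) (by omega) (by omega)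
  obtain ⟨w, hw⟩ := h.left (u := q n) (v := p (n + 1)) (i := e (n + 1)) (by omega) (by omega)
  have hvR : e (n + 1) ≤ R v := by
    by_contra hc
    exact hG.not_graphR n (s.isIndContained_graphR h (v := v) (w := w) (by omega) (by omega)
      (by omega) (by omega) fun hm => by have := hm.2; omega)
  have hzL : L z ≤ R (q n) := by
    by_contra hc
    have := h.le z
    exact hG.not_graphR n (s.isIndContained_graphR h (v := z) (w := w) (by omega) (by omega)
      (by omega) (by omega) fun hm => by have := hm.2; omega)
  have hapex : e n < L z → False := fun hlt => by
    refine hG.not_graphS (i := n + 1) (by omega) (s.isIndContained_apex h hv hw hvR hzL hz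
      (by omega) hlt.le ?_ ?_ ?_ ?_)
    · exact fun _ _ => Iff.rfl
    · exact fun a => by rcases a with _ | _ | _ <;> exact id
    · exact fun _ => Iff.rfl
    · exact fun m => ⟨fun hm => .inl hm, fun hm => hm.resolve_right fun h => by omega⟩
  rcases Nat.eq_zero_or_pos n with rfl | hn
  · refine hG.not_graphG₁ (s.isIndContained_graphG₁ h hv hw hvR (not_lt.1 hapex) hz ?_)
    omega
  · have hzn : e n ≤ L z := not_lt.1 fun hlt => hcon hn.ne' z v hlt hz hv
    rcases hzn.lt_or_eq with hlt | heq
    · exact hapex hlt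
    · refine hG.not_graphS'' (i := n + 1) (by omega) (s.isIndContained_apex h hv hw hvR hzL hz
        (by omega) hzn ?_ ?_ ?_ ?_)
      · exact fun _ _ => Iff.rfl
      · exact fun a => by rcases a with _ | _ | _ <;> exact id
      · exact fun _ => Iff.rfl
      · exact fun m => ⟨fun hm => hm.imp_right fun hm => ⟨hm, heq.symm⟩,
          fun hm => hm.imp_right And.left⟩

/-- In a free graph each strip is tight at its end. -/
theorem gap (h : Canonical G L R) (hG : IsFreeOfForbidden G) (s : Strip L R n e p q) :
    R (q n) + 1 = e (n + 1) := by
  induction n generalizing e p with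
  | zero => exact (s.gap_or h hG).resolve_right fun h => h.1 rfl
  | succ n ih =>
    refine (s.gap_or h hG).resolve_right ?_
    rintro ⟨-, z, v, hz, hz', hv⟩
    have h1 := s.lq n (by omega)
    have h2 := h.le (q (n + 1))
    -- `z` properly contains `q (n + 1)` and `v` starts where `z` ends, so they open a left-going
    -- strip. Its tightness gives `L z = e (n + 1) - 1`.
    have s' := Strip.of_claw (L := fun v => -R v) (R := fun v => -L v) (l := v) (c := z)
      (m := q (n + 1)) (by omega) (by omega) (by omega)
    have h3 := (s'.gap_or h.reverse hG).resolve_right fun h => h.1 rfl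
    simp only [zero_add, one_ne_zero, if_false] at h3
    have h4 := ih s.truncate
    have h5 := s.lt_succ h (m := n) (by omega)
    have h6 := s.rp (n + 1) (by omega)
    have h7 := s.le_lq (m := n) (by omega)
    -- Either the two strips cross and yield `graphT`, or `z` starts with `p (n + 1)` and can
    -- replace it in the truncated strip, where it ends too late to be tight.
    rcases (show e n ≤ e (n + 1) - 1 by omega).lt_or_eq with h8 | h8
    · refine s.truncate.false_of_cross h hG s' ?_ ?_ ?_ ?_ ?_ <;> first | omega | (simp; omega)
    · have s2 := s.truncate.replace (z := z) (by omega) (by omega)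
      have h9 := ih s2
      simp at h9
      omega

/-- In a free graph no right-going strip ends where a left-going one does. -/
theorem false_of_opposite (h : Canonical G L R) (hG : IsFreeOfForbidden G)
    (s : Strip L R n e p q) {j : ℕ} {e' : ℕ → ℤ} {p' q' : ℕ → V}
    (s' : Strip (fun v => -R v) (fun v => -L v) j e' p' q')
    (hb : e (n + 1) + e' (j + 1) = 1) : False := by
  induction j generalizing n e p q with
  | zero =>
    have h1 := s.gap h hG
    have h2 := s'.gap h.reverse hG
    have h3 := s.lt_succ h (m := n) le_rfl
    have h5 := s'.l0
    have h6 := h.le (q' 0)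
    have h7 := s'.rp 1 le_rfl
    have h8 := s.rp (n + 1) le_rfl
    have h9 := s'.lp 0 le_rfl
    simp only [zero_add] at *
    -- Otherwise `p' 1` could replace `p (n + 1)` and by tightness would end at `e (n + 1)`; but it
    -- ends beyond `q' 0`, which starts there.
    have d1 : e n < e (n + 1) - 1 := by
      by_contra hc
      have h10 := (s.replace (z := p' 1) (by omega) (by omega)).gap h hG
      simp at h10
      omega
    refine s.false_of_cross h hG s' ?_ ?_ ?_ ?_ ?_ <;> first | omega | (simp only [zero_add]; omega)
  | succ j ih =>
    have h1 := s.gap h hG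
    have h2 := s'.gap h.reverse hG
    have h3 := s.lt_succ h (m := n) le_rfl
    have h4 := s'.lt_succ h.reverse (m := j + 1) le_rfl
    have h4' := s'.lt_succ h.reverse (m := j) (by omega)
    have h5 := s'.lq j (by omega)
    have h6 := s'.lp (j + 1) le_rfl
    have h7 := s'.rp (j + 1 + 1) le_rfl
    have h8 := s.rp (n + 1) le_rfl
    have h9 := s'.rp (j + 1) (by omega)
    have h10 := s'.lp j (by omega)
    have h11 := s.lp n (by omega)
    by_cases d1 : e n < e (n + 1) - 1
    · by_cases d2 : e (n + 1) < -e' (j + 1)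
      · refine s.false_of_cross h hG s' ?_ ?_ ?_ ?_ ?_ <;> omega
      · have h12 := (s'.replace (z := p (n + 1)) (by omega) (by omega)).gap h.reverse hG
        simp only [Function.update_self] at h12
        omega
    -- Here `p' (j + 2)` ends at `e (n + 1)`, so `p' (j + 1)` and `q' (j + 1)` both start there and
    -- extend `s`. The meeting place moves one unit to the right while the left-going strip loses a
    -- triangle.
    · have h12 := (s.replace (z := p' (j + 1 + 1)) (by omega) (by omega)).gap h hG
      simp only [Function.update_self] at h12
      have s2 := s.extend (u := p' (j + 1)) (t := q' (j + 1)) (by omega) (by omega) (by omega)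
      have h13 := s2.gap h hG
      simp only [Function.update_self] at h13
      refine ih s2 s'.truncate ?_
      simp only [Function.update_self]
      omega

end Strip

/-! ### Locked end points and tame models. -/

/-- `b` is the end of a strip, so the vertices with left end `b` are left closed. -/
def Locked (L R : V → ℤ) (b : ℤ) : Prop :=
  ∃ n e p q, Strip L R n e p q ∧ e (n + 1) = b

/-- The order constraints on an interval model that give rise to a mixed unit interval model. -/
structure Tame (L R : V → ℤ) (A B : ℤ → Prop) : Prop where
  le : ∀ v, L v ≤ R v
  nest : ∀ {u c}, L c < L u → R u < R c → L u = L c + 1 ∧ R c = R u + 1 ∧ A (R c) ∧ B (L c)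
  right : ∀ {u v}, A (L u) → L u = L v → R u < R v → R v = R u + 1 ∧ A (R v)
  left : ∀ {u v}, B (R u) → R u = R v → L u < L v → L v = L u + 1 ∧ B (L u)
  sep : ∀ {b}, A b → ¬ B (b - 1)

/-- A vertex ending at `L c` exists in a canonical model; with `c` and `u` it forms a claw, hence a
strip of length zero that is tight. -/
theorem Canonical.locked_of_nest {L R : V → ℤ} (h : Canonical G L R) (hG : IsFreeOfForbidden G)
    {u c : V} (h1 : L c < L u) (h2 : R u < R c) : R c = R u + 1 ∧ Locked L R (R c) := by
  obtain ⟨l, hl⟩ := h.right (u := c) (v := c) le_rfl (h.le c)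
  have s := Strip.of_claw hl h1 h2
  have := s.gap h hG
  simp only [zero_add, one_ne_zero, if_false] at this
  exact ⟨this.symm, _, _, _, _, s, by simp⟩

theorem Canonical.locked_step {L R : V → ℤ} (h : Canonical G L R) (hG : IsFreeOfForbidden G)
    {u v : V} (h1 : Locked L R (L u)) (h2 : L u = L v) (h3 : R u < R v) :
    R v = R u + 1 ∧ Locked L R (R v) := by
  obtain ⟨n, e, p, q, s, hb⟩ := h1
  have s2 := s.extend (u := v) (t := u) (by omega) (by omega) h3
  have := s2.gap h hG
  simp only [Function.update_self] at this
  exact ⟨this.symm, _, _, _, _, s2, by simp⟩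

/-- The second predicate is `Locked` in the reflected model, so half of the conditions are mirror
images, and `sep` says that opposite strips do not meet. -/
theorem Canonical.tame {L R : V → ℤ} (h : Canonical G L R) (hG : IsFreeOfForbidden G) :
    Tame L R (Locked L R) (fun a => Locked (fun v => -R v) (fun v => -L v) (-a)) where
  le := h.le
  nest {u c} h1 h2 := by
    obtain ⟨a1, a2⟩ := h.locked_of_nest hG h1 h2
    obtain ⟨b1, b2⟩ := h.reverse.locked_of_nest hG (u := u) (c := c) (by omega) (by omega)
    exact ⟨by omega, a1, a2, b2⟩
  right := h.locked_step hG
  left {u v} h1 h2 h3 := by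
    obtain ⟨b1, b2⟩ := h.reverse.locked_step hG (u := v) (v := u) (h2 ▸ h1) (by omega) (by omega)
    exact ⟨by omega, b2⟩
  sep {b} h1 h2 := by
    obtain ⟨n, e, p, q, s, hb⟩ := h1
    obtain ⟨j, e', p', q', s', hb'⟩ := h2
    exact s.false_of_opposite h hG s' (by omega)

/-! ### The level of a vertex and its compatibility with both end points. -/

namespace Tame

variable {L R : V → ℤ} {A B : ℤ → Prop}

theorem reverse (h : Tame L R A B) :
    Tame (fun v => -R v) (fun v => -L v) (fun a => B (-a)) (fun b => A (-b)) where
  le v := neg_le_neg (h.le v)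
  nest {u c} h1 h2 := by
    obtain ⟨a1, a2, a3, a4⟩ := h.nest (u := u) (c := c) (by omega) (by omega)
    simp only [neg_neg]
    exact ⟨by omega, by omega, a4, a3⟩
  right {u v} h1 h2 h3 := by
    simp only [neg_neg] at *
    obtain ⟨a1, a2⟩ := h.left (u := v) (v := u) (by rwa [← neg_inj.1 h2]) (by omega) (by omega)
    exact ⟨by omega, a2⟩
  left {u v} h1 h2 h3 := by
    simp only [neg_neg] at *
    obtain ⟨a1, a2⟩ := h.right (u := v) (v := u) (by rwa [← neg_inj.1 h2]) (by omega) (by omega)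
    exact ⟨by omega, a2⟩
  sep {b} h1 h2 := h.sep h2 (by rwa [show -(b - 1) - 1 = -b by ring])

/-- `v` has a longer companion with the same left end. -/
def Up (L R : V → ℤ) (A : ℤ → Prop) (v : V) : Prop := A (L v) ∧ ∃ w, L w = L v ∧ R w = R v + 1

/-- `v` has a longer companion with the same right end. -/
def Down (L R : V → ℤ) (B : ℤ → Prop) (v : V) : Prop := B (R v) ∧ ∃ w, L w = L v - 1 ∧ R w = R v

open Classical in
/-- Twice the centre of the interval of `v`, corrected so that companions get equal values. -/
noncomputable def level (L R : V → ℤ) (A B : ℤ → Prop) (v : V) : ℤ :=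
  L v + R v + (if Up L R A v then 1 else 0) - (if Down L R B v then 1 else 0)

theorem level_reverse (v : V) :
    level (fun v => -R v) (fun v => -L v) (fun a => B (-a)) (fun b => A (-b)) v =
      -level L R A B v := by
  have h1 : Up (fun v => -R v) (fun v => -L v) (fun a => B (-a)) v ↔ Down L R B v := by
    simp only [Up, Down, neg_neg]
    refine and_congr_right fun _ => exists_congr fun w => ?_
    constructor <;> rintro ⟨h1, h2⟩ <;> constructor <;> omega
  have h2 : Down (fun v => -R v) (fun v => -L v) (fun a => A (-a)) v ↔ Up L R A v := by
    simp only [Up, Down, neg_neg]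
    refine and_congr_right fun _ => exists_congr fun w => ?_
    constructor <;> rintro ⟨h1, h2⟩ <;> constructor <;> omega
  unfold level
  rw [propext h1, propext h2]
  ring

theorem level_eq (L R : V → ℤ) (A B : ℤ → Prop) (v : V) :
    (Up L R A v ∧ Down L R B v ∧ level L R A B v = L v + R v) ∨
    (Up L R A v ∧ ¬ Down L R B v ∧ level L R A B v = L v + R v + 1) ∨
    (¬ Up L R A v ∧ Down L R B v ∧ level L R A B v = L v + R v - 1) ∨
    (¬ Up L R A v ∧ ¬ Down L R B v ∧ level L R A B v = L v + R v) := by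
  by_cases h1 : Up L R A v <;> by_cases h2 : Down L R B v <;> simp [level, h1, h2]

/-- Nested intervals have the same centre, and none of the corrections applies: a companion of `c`
would contain `u` with too much room, and one of `u` would contradict `sep`. -/
theorem level_of_nest (h : Tame L R A B) {u c : V} (h1 : L c < L u) (h2 : R u < R c) :
    level L R A B u = level L R A B c := by
  obtain ⟨a1, a2, a3, a4⟩ := h.nest h1 h2
  have n1 : ¬ Up L R A c := by
    rintro ⟨-, w, hw, hw'⟩
    have := h.nest (u := u) (c := w) (by omega) (by omega)
    omega
  have n2 : ¬ Down L R B c := by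
    rintro ⟨-, w, hw, hw'⟩
    have := h.nest (u := u) (c := w) (by omega) (by omega)
    omega
  have n3 : ¬ Up L R A u := fun hu => h.sep hu.1 (by rwa [a1, add_sub_cancel_right])
  have n4 : ¬ Down L R B u := fun hu => h.sep a3 (by rw [a2, add_sub_cancel_right]; exact hu.1)
  simp only [level, n1, n2, n3, n4, if_false]
  omega

theorem not_down (h : Tame L R A B) {v : V} (hv : A (L v)) : ¬ Down L R B v := by
  rintro ⟨h1, w, hw, hw'⟩
  obtain ⟨-, h2⟩ := h.left (u := w) (v := v) (by rwa [hw']) hw' (by omega)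
  exact h.sep hv (hw ▸ h2)

theorem level_of_left_aux (h : Tame L R A B) {v w : V} (hv : A (L v)) (hvw : L v = L w)
    (hR : R v < R w) : level L R A B v = level L R A B w := by
  obtain ⟨h1, h2⟩ := h.right hv hvw hR
  have n1 : Up L R A v := ⟨hv, w, hvw.symm, h1⟩
  have n2 : ¬ Up L R A w := by
    rintro ⟨-, x, hx, hx'⟩
    have := h.right (u := v) (v := x) hv (by omega) (by omega)
    omega
  have n3 := h.not_down hv
  have n4 := h.not_down (v := w) (hvw ▸ hv)
  simp only [level, n1, n2, n3, n4, if_false, if_true]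
  omega

theorem level_of_left (h : Tame L R A B) {v w : V} (hv : A (L v)) (hvw : L v = L w) :
    level L R A B v = level L R A B w := by
  rcases lt_trichotomy (R v) (R w) with hR | hR | hR
  · exact h.level_of_left_aux hv hvw hR
  · have h1 : Up L R A v ↔ Up L R A w := by simp only [Up, hvw, hR]
    have h2 : Down L R B v ↔ Down L R B w := by simp only [Down, hvw, hR]
    unfold level
    rw [propext h1, propext h2, hvw, hR]
  · exact (h.level_of_left_aux (hvw ▸ hv) hvw.symm hR).symm

theorem level_of_right (h : Tame L R A B) {v w : V} (hv : B (R v)) (hvw : R v = R w) :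
    level L R A B v = level L R A B w := by
  have := h.reverse.level_of_left (v := v) (w := w) (by simpa using hv) (by omega)
  rw [level_reverse, level_reverse] at this
  omega

theorem le_of_level_lt_aux (h : Tame L R A B) {u v : V} (huv : level L R A B u < level L R A B v) :
    L u ≤ L v := by
  by_contra hc
  have hR : R v ≤ R u := by
    by_contra hR
    exact huv.ne (h.level_of_nest (not_le.1 hc) (not_le.1 hR))
  -- The sums of end points can be out of step with the levels only if both corrections act. Then
  -- the companion of `v` properly contains `u`, and its locked right end contradicts the lock at `R
  -- u`.
  have key : Up L R A v → Down L R B u → L v + R v + 1 = L u + R u → False := by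
    rintro ⟨h1, w, hw, hw'⟩ ⟨h2, -⟩ h3
    obtain ⟨-, -, h4, -⟩ := h.nest (u := u) (c := w) (by omega) (by omega)
    refine h.sep h4 ?_
    rwa [show R w - 1 = R u by omega]
  rcases level_eq L R A B u with ⟨-, h2, h3⟩ | ⟨-, h2, h3⟩ | ⟨-, h2, h3⟩ | ⟨-, h2, h3⟩ <;>
    rcases level_eq L R A B v with ⟨k1, -, k3⟩ | ⟨k1, -, k3⟩ | ⟨k1, -, k3⟩ | ⟨k1, -, k3⟩ <;>
    first
    | omega
    | exact (key k1 h2 (by omega)).elim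

theorem le_of_level_lt (h : Tame L R A B) {u v : V} (huv : level L R A B u < level L R A B v) :
    L u ≤ L v ∧ R u ≤ R v := by
  refine ⟨h.le_of_level_lt_aux huv, ?_⟩
  have := h.reverse.le_of_level_lt_aux (u := v) (v := u)
    (by rw [level_reverse, level_reverse]; omega)
  omega

theorem right_of_level_eq (h : Tame L R A B) {u v : V}
    (huv : level L R A B u = level L R A B v) (hR : R u < R v) : R v = R u + 1 ∧ A (R v) := by
  by_cases hL : L v < L u
  · obtain ⟨-, h1, h2, -⟩ := h.nest hL hR
    exact ⟨h1, h2⟩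
  by_cases hu : Up L R A u
  · obtain ⟨h1, w, hw, hw'⟩ := hu
    by_cases hL' : L u = L v
    · exact h.right h1 hL' hR
    · have : R v = R u + 1 := by
        rcases level_eq L R A B u with ⟨-, h2, h3⟩ | ⟨-, h2, h3⟩ | ⟨-, h2, h3⟩ | ⟨-, h2, h3⟩ <;>
          rcases level_eq L R A B v with ⟨k1, -, k3⟩ | ⟨k1, -, k3⟩ | ⟨k1, -, k3⟩ | ⟨k1, -, k3⟩ <;> omega
      refine ⟨this, ?_⟩
      rw [this, ← hw']
      exact (h.right h1 hw.symm (by omega)).2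
  -- With `L u ≤ L v` and `R u < R v`, equal levels need a correction at `u` or at `v`. If it is at
  -- `v`, the longer companion of `v` properly contains `u`.
  · have hv : Down L R B v := by
      by_contra hv
      rcases level_eq L R A B u with ⟨h1, h2, h3⟩ | ⟨h1, h2, h3⟩ | ⟨h1, h2, h3⟩ | ⟨h1, h2, h3⟩ <;>
        rcases level_eq L R A B v with ⟨k1, k2, k3⟩ | ⟨k1, k2, k3⟩ | ⟨k1, k2, k3⟩ | ⟨k1, k2, k3⟩ <;>
        first
        | exact hu h1
        | exact hv k2
        | omega
    obtain ⟨h1, w, hw, hw'⟩ := hv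
    have hL' : L u = L v := by
      rcases level_eq L R A B u with ⟨h1, h2, h3⟩ | ⟨h1, h2, h3⟩ | ⟨h1, h2, h3⟩ | ⟨h1, h2, h3⟩ <;>
        rcases level_eq L R A B v with ⟨k1, k2, k3⟩ | ⟨k1, k2, k3⟩ | ⟨k1, k2, k3⟩ | ⟨k1, k2, k3⟩ <;>
        first
        | exact absurd h1 hu
        | omega
    obtain ⟨-, h2, h3, -⟩ := h.nest (u := u) (c := w) (by omega) (by omega)
    exact ⟨by omega, hw' ▸ h3⟩

theorem left_of_level_eq (h : Tame L R A B) {u v : V}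
    (huv : level L R A B u = level L R A B v) (hL : L u < L v) : L v = L u + 1 ∧ B (L u) := by
  obtain ⟨h1, h2⟩ := h.reverse.right_of_level_eq (u := v) (v := u)
    (by rw [level_reverse, level_reverse, huv]) (by omega)
  simp only [neg_neg] at h2
  exact ⟨by omega, h2⟩

theorem le_of_level_eq (h : Tame L R A B) {u v : V}
    (huv : level L R A B u = level L R A B v) : L v ≤ R u := by
  by_contra hc
  have h1 := h.le u
  have h2 := h.le v
  obtain ⟨h3, h4⟩ := h.right_of_level_eq huv (by omega)
  obtain ⟨h5, h6⟩ := h.left_of_level_eq huv (by omega)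
  refine h.sep h4 ?_
  rwa [show R v - 1 = L u by omega]

end Tame

/-! ### From a ranking to a mixed unit interval model. -/

/-- A ranking of the vertices by left end points, as in a mixed unit interval model. -/
structure Ranking (G : SimpleGraph V) {κ : Type*} [LinearOrder κ] (f : V → κ) : Prop where
  same : ∀ {u v}, f u = f v → u ≠ v → G.Adj u v
  between_left : ∀ {u v w u'}, f u < f v → f v < f w → G.Adj u w → f u' = f u → G.Adj u' v
  between_right : ∀ {u v w w'}, f u < f v → f v < f w → G.Adj u w → f w' = f w → G.Adj v w'
  rectangle : ∀ {u u' v v'}, f u < f v → f u' = f u → f v' = f v → G.Adj u v → G.Adj u' v' →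
    G.Adj u v'

theorem Tame.ranking {L R : V → ℤ} {A B : ℤ → Prop} (h : Tame L R A B)
    (hG : ∀ u v, G.Adj u v ↔ u ≠ v ∧ L u ≤ R v ∧ L v ≤ R u) :
    Ranking G (Tame.level L R A B) where
  same {u v} huv hne := (hG u v).2 ⟨hne, h.le_of_level_eq huv.symm, h.le_of_level_eq huv⟩
  between_left {u v w u'} h1 h2 h3 h4 := by
    have hne : u' ≠ v := by rintro rfl; exact h1.ne' h4
    obtain ⟨-, a1, a2⟩ := (hG u w).1 h3
    have b1 := h.le_of_level_lt h1
    have b2 := h.le_of_level_lt h2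
    have b3 := h.le_of_level_lt (h4 ▸ h1)
    have := h.le v
    refine (hG u' v).2 ⟨hne, by omega, ?_⟩
    by_contra hc
    obtain ⟨c1, c2⟩ := h.right_of_level_eq h4 (by omega)
    -- `v` and `w` then share the left end `R u`, which is locked, so their levels would agree.
    have e1 : L v = R u := by omega
    exact h2.ne (h.level_of_left (by rwa [e1]) (by omega))
  between_right {u v w w'} h1 h2 h3 h4 := by
    have hne : v ≠ w' := by rintro rfl; exact h2.ne h4
    obtain ⟨-, a1, a2⟩ := (hG u w).1 h3
    have b1 := h.le_of_level_lt h1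
    have b2 := h.le_of_level_lt h2
    have b3 := h.le_of_level_lt (h2.trans_eq h4.symm)
    have := h.le v
    have := h.le w'
    refine (hG v w').2 ⟨hne, by omega, ?_⟩
    by_contra hc
    obtain ⟨c1, c2⟩ := h.left_of_level_eq h4.symm (by omega)
    have e1 : R v = L w := by omega
    exact h1.ne' (h.level_of_right (by rwa [e1]) (by omega))
  rectangle {u u' v v'} h1 h2 h3 h4 h5 := by
    have hne : u ≠ v' := by rintro rfl; exact h1.ne h3
    obtain ⟨-, a1, a2⟩ := (hG u v).1 h4
    obtain ⟨-, a3, a4⟩ := (hG u' v').1 h5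
    have b := h.le_of_level_lt (h1.trans_eq h3.symm)
    have := h.le v'
    refine (hG u v').2 ⟨hne, by omega, ?_⟩
    by_contra hc
    obtain ⟨c1, c2⟩ := h.right_of_level_eq h2.symm (by omega)
    obtain ⟨d1, d2⟩ := h.left_of_level_eq h3.symm (by omega)
    refine h.sep c2 ?_
    rwa [show R u' - 1 = L v by omega]

namespace Ranking

variable {κ : Type*} {f : V → κ}

/-- Some vertex of rank `a` is adjacent to some vertex of rank `b`. -/
def Linked (G : SimpleGraph V) (f : V → κ) (a b : κ) : Prop :=
  ∃ u v, f u = a ∧ f v = b ∧ G.Adj u v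

/-- All vertices of rank `a` are adjacent to all vertices of rank `b`. -/
def Full (G : SimpleGraph V) (f : V → κ) (a b : κ) : Prop :=
  ∀ u v, f u = a → f v = b → G.Adj u v

theorem linked_of_full {a b : κ} (ha : a ∈ Set.range f) (hb : b ∈ Set.range f)
    (h : Full G f a b) : Linked G f a b := by
  obtain ⟨u, rfl⟩ := ha
  obtain ⟨v, rfl⟩ := hb
  exact ⟨u, v, rfl, rfl, h u v rfl rfl⟩

/-- The position `y` of rank `b` is compatible with the position `x` of rank `a < b`. -/
structure Fits (G : SimpleGraph V) (f : V → κ) (a b : κ) (x y : ℝ) : Prop where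
  lt : x < y
  apart : ¬ Linked G f a b → x + 1 < y
  overlap : Linked G f a b → Full G f a b → y < x + 1
  touch : Linked G f a b → ¬ Full G f a b → y = x + 1

variable [LinearOrder κ]

theorem full_left (h : Ranking G f) {a b c : κ} (hab : a < b) (hbc : b < c)
    (hac : Linked G f a c) : Full G f a b := by
  obtain ⟨u, w, rfl, rfl, huw⟩ := hac
  rintro u' v h1 rfl
  exact h.between_left hab hbc huw h1

theorem full_right (h : Ranking G f) {a b c : κ} (hab : a < b) (hbc : b < c)
    (hac : Linked G f a c) : Full G f b c := by
  obtain ⟨u, w, rfl, rfl, huw⟩ := hac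
  rintro v w' rfl h1
  exact h.between_right hab hbc huw h1

/-- A partial pair with rank `c` forces the position `x b + 1`. Without one, `near` and `before` put
every lower bound below every upper bound, and density of the reals supplies `y`. -/
theorem exists_position_aux (h : Ranking G f) (s : Finset κ) (c : κ) (hs : ∀ a ∈ s, a < c)
    (hf : ∀ a ∈ s, a ∈ Set.range f) (hc : c ∈ Set.range f) (x : κ → ℝ)
    (hx : ∀ a ∈ s, ∀ b ∈ s, a < b → Fits G f a b (x a) (x b)) :
    ∃ y, ∀ a ∈ s, Fits G f a c (x a) y := by
  classical
  have near : ∀ a ∈ s, ∀ b ∈ s, Linked G f b c → x a < x b + 1 := by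
    intro a ha b hb hbc
    rcases lt_trichotomy a b with h1 | rfl | h1
    · linarith [(hx a ha b hb h1).lt]
    · linarith
    · have := h.full_left h1 (hs a ha) hbc
      exact (hx b hb a ha h1).overlap (linked_of_full (hf b hb) (hf a ha) this) this
  have before : ∀ a ∈ s, ∀ b ∈ s, ¬ Linked G f a c → Linked G f b c → x a < x b := by
    intro a ha b hb hac hbc
    rcases lt_trichotomy a b with h1 | rfl | h1
    · exact (hx a ha b hb h1).lt
    · exact absurd hbc hac
    · exact absurd (linked_of_full (hf a ha) hc (h.full_right h1 (hs a ha) hbc)) hac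
  by_cases hp : ∃ a ∈ s, Linked G f a c ∧ ¬ Full G f a c
  · obtain ⟨b, hb, hbc, hbc'⟩ := hp
    refine ⟨x b + 1, fun a ha => ⟨near a ha b hb hbc, fun hac => ?_, fun hac hac' => ?_,
      fun hac hac' => ?_⟩⟩
    · linarith [before a ha b hb hac hbc]
    · rcases lt_trichotomy a b with h1 | rfl | h1
      · exact absurd (h.full_right h1 (hs b hb) hac) hbc'
      · exact absurd hac' hbc'
      · linarith [(hx b hb a ha h1).lt]
    · rcases lt_trichotomy a b with h1 | rfl | h1
      · exact absurd (h.full_right h1 (hs b hb) hac) hbc'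
      · rfl
      · exact absurd (h.full_right h1 (hs a ha) hbc) hac'
  · push Not at hp
    obtain ⟨y, hlo, hhi⟩ := Order.exists_between_finsets
      (lo := s.image x ∪ (s.filter (fun a => ¬ Linked G f a c)).image (fun a => x a + 1))
      (hi := (s.filter (fun a => Linked G f a c)).image (fun a => x a + 1)) (by
        intro t ht t' ht'
        simp only [Finset.mem_union, Finset.mem_image, Finset.mem_filter] at ht ht'
        obtain ⟨b, ⟨hb, hbc⟩, rfl⟩ := ht'
        rcases ht with ⟨a, ha, rfl⟩ | ⟨a, ⟨ha, hac⟩, rfl⟩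
        · exact near a ha b hb hbc
        · linarith [before a ha b hb hac hbc])
    refine ⟨y, fun a ha => ⟨?_, fun hac => ?_, fun hac _ => ?_,
      fun hac hac' => absurd (hp a ha hac) hac'⟩⟩
    · exact hlo _ (Finset.mem_union_left _ (Finset.mem_image_of_mem _ ha))
    · exact hlo _ (Finset.mem_union_right _
        (Finset.mem_image_of_mem (fun a => x a + 1) (Finset.mem_filter.2 ⟨ha, hac⟩)))
    · exact hhi _ (Finset.mem_image_of_mem (fun a => x a + 1) (Finset.mem_filter.2 ⟨ha, hac⟩))

theorem exists_position (h : Ranking G f) (s : Finset κ) (hf : ∀ a ∈ s, a ∈ Set.range f) :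
    ∃ x : κ → ℝ, ∀ a ∈ s, ∀ b ∈ s, a < b → Fits G f a b (x a) (x b) := by
  classical
  induction s using Finset.induction_on_max with
  | empty => exact ⟨0, by simp⟩
  | insert c s hs ih =>
    obtain ⟨x, hx⟩ := ih fun a ha => hf a (Finset.mem_insert_of_mem ha)
    obtain ⟨y, hy⟩ := h.exists_position_aux s c hs
      (fun a ha => hf a (Finset.mem_insert_of_mem ha)) (hf c (Finset.mem_insert_self _ _)) x hx
    refine ⟨Function.update x c y, fun a ha b hb hab => ?_⟩
    rcases Finset.mem_insert.1 ha with rfl | ha' <;> rcases Finset.mem_insert.1 hb with rfl | hb'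
    · exact absurd hab (lt_irrefl _)
    · exact absurd hab (hs b hb').not_gt
    · rw [Function.update_self, Function.update_of_ne hab.ne]
      exact hy a ha'
    · rw [Function.update_of_ne (hs a ha').ne, Function.update_of_ne (hs b hb').ne]
      exact hx a ha' b hb' hab

theorem isMixedUnitIntervalGraph [Finite V] (h : Ranking G f) : IsMixedUnitIntervalGraph G := by
  classical
  cases nonempty_fintype V
  obtain ⟨x, hx⟩ := h.exists_position (Finset.univ.image f) (by simp)
  have fits : ∀ u v, f u < f v → Fits G f (f u) (f v) (x (f u)) (x (f v)) := fun u v huv =>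
    hx _ (by simp) _ (by simp) huv
  -- An end is closed exactly when it must realise an edge between two ranks that are only partially
  -- adjacent.
  let rc : V → Prop := fun u => ∃ v, f u < f v ∧ G.Adj u v ∧ ¬ Full G f (f u) (f v)
  let lc : V → Prop := fun v => ∃ u, f u < f v ∧ G.Adj u v ∧ ¬ Full G f (f u) (f v)
  let I : V → Set ℝ := fun v => {t | (x (f v) < t ∨ (x (f v) = t ∧ lc v)) ∧
    (t < x (f v) + 1 ∨ (t = x (f v) + 1 ∧ rc v))}
  have memI : ∀ v t, t ∈ I v ↔ (x (f v) < t ∨ (x (f v) = t ∧ lc v)) ∧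
    (t < x (f v) + 1 ∨ (t = x (f v) + 1 ∧ rc v)) := fun v t => Iff.rfl
  have main : ∀ u v, f u < f v → (G.Adj u v ↔ (I u ∩ I v).Nonempty) := by
    intro u v huv
    have hF := fits u v huv
    constructor
    · intro hadj
      have hL : Linked G f (f u) (f v) := ⟨u, v, rfl, rfl, hadj⟩
      by_cases hfull : Full G f (f u) (f v)
      · have h1 := hF.overlap hL hfull
        have h2 := hF.lt
        refine ⟨(x (f v) + (x (f u) + 1)) / 2, ⟨.inl ?_, .inl ?_⟩, ⟨.inl ?_, .inl ?_⟩⟩ <;> linarith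
      · have h1 := hF.touch hL hfull
        have h2 := hF.lt
        exact ⟨x (f v), ⟨.inl h2, .inr ⟨h1, v, huv, hadj, hfull⟩⟩,
          ⟨.inr ⟨rfl, u, huv, hadj, hfull⟩, .inl (by linarith)⟩⟩
    · rintro ⟨t, ⟨-, h1⟩, ⟨h2, -⟩⟩
      by_cases hL : Linked G f (f u) (f v)
      · by_cases hfull : Full G f (f u) (f v)
        · exact hfull u v rfl rfl
        have h3 := hF.touch hL hfull
        have h4 : rc u := by
          rcases h1 with h1 | h1
          · rcases h2 with h2 | h2 <;> linarith
          · exact h1.2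
        have h5 : lc v := by
          rcases h2 with h2 | h2
          · rcases h1 with h1 | h1 <;> linarith
          · exact h2.2
        obtain ⟨v', a1, a2, a3⟩ := h4
        obtain ⟨u', b1, b2, b3⟩ := h5
        have a4 := (fits u v' a1).touch ⟨u, v', rfl, rfl, a2⟩ a3
        have b4 := (fits u' v b1).touch ⟨u', v, rfl, rfl, b2⟩ b3
        have inj : ∀ w w', x (f w) = x (f w') → f w = f w' := by
          intro w w' hw
          rcases lt_trichotomy (f w) (f w') with h1 | h1 | h1
          · exact absurd hw (fits _ _ h1).lt.ne
          · exact h1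
          · exact absurd hw (fits _ _ h1).lt.ne'
        -- The vertices that cause the two closed ends lie one unit off, hence in the ranks of `v`
        -- and `u`; `rectangle` turns the two edges into the edge from `u` to `v`.
        have a5 := inj v v' (by linarith)
        have b5 := inj u' u (by linarith)
        exact h.rectangle a1 b5 a5 a2 b2
      · have := hF.apart hL
        rcases h1 with h1 | h1 <;> rcases h2 with h2 | h2 <;> linarith
  refine ⟨I, fun v => ⟨x (f v), ?_⟩, fun u v huv => ?_⟩
  · by_cases hl : lc v <;> by_cases hr : rc v
    · left
      ext t; rw [memI, Set.mem_Icc]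
      simp only [hl, hr, and_true, ← le_iff_lt_or_eq]
    · right; right; right
      ext t; rw [memI, Set.mem_Ico]
      simp only [hl, hr, and_true, and_false, or_false, ← le_iff_lt_or_eq]
    · right; right; left
      ext t; rw [memI, Set.mem_Ioc]
      simp only [hl, hr, and_true, and_false, or_false, ← le_iff_lt_or_eq]
    · right; left
      ext t; rw [memI, Set.mem_Ioo]
      simp only [hl, hr, and_false, or_false]
  · rcases lt_trichotomy (f u) (f v) with h1 | h1 | h1
    · exact main u v h1
    · refine iff_of_true (h.same h1 huv) ⟨x (f u) + 1 / 2, ⟨.inl ?_, .inl ?_⟩, ⟨.inl ?_, .inl ?_⟩⟩ <;>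
        (try rw [← h1]) <;> linarith
    · rw [G.adj_comm, Set.inter_comm]
      exact main v u h1

end Ranking

end MixedUnitInterval

theorem corollary3p4 {V : Type*} [Finite V] (G : SimpleGraph V) :
    MixedUnitInterval.IsMixedUnitIntervalGraph G ↔
      MixedUnitInterval.IsIntervalGraph G ∧
        MixedUnitInterval.IsFreeOf G
          ({⟨Fin 6, MixedUnitInterval.graphG₁⟩} ∪ MixedUnitInterval.familyR ∪
            MixedUnitInterval.familyS ∪ MixedUnitInterval.familyS'' ∪
            MixedUnitInterval.familyT) := by
  refine ⟨fun h => ⟨h.isIntervalGraph, h.isFreeOf⟩, fun ⟨hI, hG⟩ => ?_⟩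
  obtain ⟨L, R, h⟩ := hI.exists_canonical
  exact ((h.tame hG).ranking h.adj).isMixedUnitIntervalGraph
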